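/- Let $n,m,p,N$ be nonnegative integers with $N\ge n$. Consider the system $x_{t+1}=f(x_t,u_t)=f_0(x_t)+Bu_t$ with output $y_t=h_0(x_t)+Du_t$, where $f_0:\mathbb{R}^n\to\mathbb{R}^n$, $h_0:\mathbb{R}^n\to\mathbb{R}^p$, $B\in\mathbb{R}^{n\times m}$, $D\in\mathbb{R}^{p\times m}$. Let $\mathbb{U}\subset\mathbb{R}^m$ be compact, let $\mathbb{U}^{s}\subseteq\operatorname{int}(\mathbb{U})$ be convex and compact, let $y^{r}\in\mathbb{R}^p$, and let $Q,R,S$ be symmetric positive definite matrices; write $\|v\|_P^2=v^\top Pv$. For $z\in\mathbb{R}^n$ let $A_z$ and $C_z$ be the Jacobians of $f_0$ and $h_0$ at $z$, and put $e_z=f_0(z)-A_zz$, $r_z=h_0(z)-C_zz$, $f_z(x,u)=A_zx+Bu+e_z$, $h_z(x,u)=C_zx+Du+r_z$, $$\mathcal{Z}^{s}_{lin}(z)=\{(x^s,u^s)\in\mathbb{R}^n\times\mathbb{U}^s : x^s=f_z(x^s,u^s)\},$$ $$J^*_{eq,lin}(z)=\min\{\|h_z(x^s,u^s)-y^r\|_S^2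 : (x^s,u^s)\in\mathcal{Z}^{s}_{lin}(z)\}.$$ The MPC problem at a state $x$ is to minimize $$\sum_{k=0}^{N-1}\big(\|\bar x_k-x^s\|_Q^2+\|\bar u_k-u^s\|_R^2\big)+\|y^s-y^r\|_S^2$$ over $\bar x_0,\dots,\bar x_N$, $\bar u_0,\dots,\bar u_{N-1}$, $x^s,u^s,y^s$ subject to $\bar x_{k+1}=f_x(\bar x_k,\bar u_k)$ and $\bar u_k\in\mathbb{U}$ for $0\le k\le N-1$, $\bar x_0=x$, $\bar x_N=x^s$, $(x^s,u^s)\in\mathcal{Z}^s_{lin}(x)$, $y^s=h_x(x^s,u^s)$. Denote its optimal cost by $J_N^*(x)$ and put $V(x)=J_N^*(x)-J^*_{eq,lin}(x)$. Assume: 1. $f_0$ and $h_0$ are twice continuously differentiable. 2. There is $\sigma_s>0$ such that, for all $z\in\mathbb{R}^n$, all $n+m$ singular values of $\begin{bmatrix}A_z-I&B\\C_z&D\end{bmatrix}$ (the square roots of the eigenvalues of its Gram matrix) are at least $\sigma_s$; in particular the matrix has full column rank. 3. There is $\sigma_c>0$ such that, for all $z\in\mathbb{R}^n$, all $n$ singular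 values of the controllability matrix $\begin{bmatrix}B&A_zB&\cdots&A_z^{n-1}B\end{bmatrix}$ (the square roots of the eigenvalues of this matrix times its transpose) are at least $\sigma_c$. 4. There is $\underline\sigma>0$ such that $\sigma_{\min}(I-A_z)\ge\underline\sigma$ for all $z\in\mathbb{R}^n$. 5. There is a compact set $\mathcal{B}\subset\mathbb{R}^n\times\mathbb{R}^m$ with $\mathcal{Z}^s_{lin}(z)\subseteq\mathcal{B}$ for all $z\in\mathbb{R}^n$. Then there exist $V_{\max}>0$, $J_{eq}^{\max}>0$ and $c_V\in(0,1)$ such that the following holds for every state $x_t$ at which the MPC problem is feasible. Let $\bar u^*_0,\dots,\bar u^*_{N-1}$ be the inputs of an optimal solution of the MPC problem at $x_t$, and let $x_{t+n}$ be the state of the nonlinear system reached from $x_t$ by $x_{t+k+1}=f(x_{t+k},\bar u_k^*)$, $k=0,\dots,n-1$. If $V(x_t)\le V_{\max}$, $J^*_{eq,lin}(x_t)\le J_{eq}^{\max}$ and $J^*_{eq,lin}(x_{t+n})\le J_{eq}^{\max}$, then the MPC problem at $x_{t+n}$ is feasible and $V(x_{t+n})\le c_V V(x_t)$. -/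

import Mathlib

namespace LinTrackMPC

noncomputable section

/-- The state, input and output spaces `ℝᵏ`, with the Euclidean norm. -/
abbrev Vec (k : ℕ) : Type := EuclideanSpace ℝ (Fin k)

/-- The weighted square `‖v‖²_P = vᵀ P v`. -/
def wsq {k : ℕ} (P : Matrix (Fin k) (Fin k) ℝ) (v : Vec k) : ℝ :=
  v.ofLp ⬝ᵥ (P.mulVec v.ofLp)

/-- `σ_min(M) ≥ σ` for a matrix `M` with at least as many rows as columns: each of its singular
values, of which there are as many as columns, is at least `σ`. A matrix with more columns than
rows has the same nonzero singular values as its transpose, which is then used instead. If this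
predicate holds with some `σ > 0`, then `M` has full column rank. -/
def SigmaMinGE {κ ι : Type*} [Fintype κ] [Fintype ι] [DecidableEq ι]
    (M : Matrix κ ι ℝ) (σ : ℝ) : Prop :=
  ∀ i < Fintype.card ι, σ ≤ (Matrix.toEuclideanLin M).singularValues i

/-- The variational description of the smallest singular value. -/
theorem sigmaMinGE_iff {κ ι : Type*} [Fintype κ] [Fintype ι] [DecidableEq ι]
    (M : Matrix κ ι ℝ) {σ : ℝ} (hσ : 0 ≤ σ) :
    SigmaMinGE M σ ↔
      ∀ v : EuclideanSpace ℝ ι, σ * ‖v‖ ≤ ‖Matrix.toEuclideanLin M v‖ := by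
  set T := Matrix.toEuclideanLin M with hT
  have hn : Module.finrank ℝ (EuclideanSpace ℝ ι) = Fintype.card ι := by simp
  have hS := T.isSymmetric_adjoint_comp_self
  have hTv : ∀ v, ‖T v‖ ^ 2 = inner ℝ ((LinearMap.adjoint T ∘ₗ T) v) v := by
    intro v
    rw [LinearMap.comp_apply, LinearMap.adjoint_inner_left, real_inner_self_eq_norm_sq]
  constructor
  · intro h v
    have key : σ ^ 2 * ‖v‖ ^ 2 ≤ ‖T v‖ ^ 2 := by
      rw [hTv, ← (hS.eigenvectorBasis hn).sum_inner_mul_inner,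
        ← (hS.eigenvectorBasis hn).sum_sq_norm_inner_right v, Finset.mul_sum]
      refine Finset.sum_le_sum fun i _ => ?_
      have h1 : σ ^ 2 ≤ hS.eigenvalues hn i := by
        rw [← T.sq_singularValues_fin hn i]
        exact pow_le_pow_left₀ hσ (h i i.2) 2
      have h2 : inner ℝ ((LinearMap.adjoint T ∘ₗ T) v) (hS.eigenvectorBasis hn i)
          = hS.eigenvalues hn i * inner ℝ (hS.eigenvectorBasis hn i) v := by
        rw [hS, hS.apply_eigenvectorBasis, inner_smul_right, real_inner_comm]
        rfl
      rw [h2, Real.norm_eq_abs, sq_abs, mul_assoc, ← sq]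
      exact mul_le_mul_of_nonneg_right h1 (sq_nonneg _)
    rw [← mul_pow] at key
    exact le_of_sq_le_sq key (norm_nonneg _)
  · intro h i hi
    set b := hS.eigenvectorBasis hn ⟨i, hi⟩ with hb
    have hb1 : ‖b‖ = 1 := (hS.eigenvectorBasis hn).orthonormal.1 _
    have h3 : ‖T b‖ ^ 2 = T.singularValues i ^ 2 := by
      rw [hTv, hb, hS.apply_eigenvectorBasis, ← hb, inner_smul_left, real_inner_self_eq_norm_sq,
        hb1, T.sq_singularValues_of_lt hn hi]
      simp
    have h4 := h b
    rw [hb1, mul_one] at h4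
    refine le_of_sq_le_sq ?_ (T.singularValues_nonneg i)
    rw [← h3]
    exact pow_le_pow_left₀ hσ h4 2

/-- The data of the control problem: the system `x⁺ = f₀(x) + B u`, `y = h₀(x) + D u` with state
in `ℝⁿ`, input in `ℝᵐ` and output in `ℝᵖ`, the input constraint set `U`, the equilibrium input
constraint set `Us`, the weights `Q`, `R`, `S`, the setpoint `yr` and the horizon `N`. -/
structure Setup (n m p : ℕ) where
  /-- drift of the dynamics -/
  f₀ : Vec n → Vec n
  /-- input matrix -/
  B : Matrix (Fin n) (Fin m) ℝ
  /-- drift of the output -/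
  h₀ : Vec n → Vec p
  /-- feedthrough matrix -/
  D : Matrix (Fin p) (Fin m) ℝ
  /-- input constraint set -/
  U : Set (Vec m)
  /-- equilibrium input constraint set -/
  Us : Set (Vec m)
  /-- state weight -/
  Q : Matrix (Fin n) (Fin n) ℝ
  /-- input weight -/
  R : Matrix (Fin m) (Fin m) ℝ
  /-- output setpoint weight -/
  S : Matrix (Fin p) (Fin p) ℝ
  /-- setpoint -/
  yr : Vec p
  /-- prediction horizon -/
  N : ℕ

/-- The decision variables of the MPC problem. The trajectories are indexed by `ℕ`; the problem
only involves `x 0, …, x N` and `u 0, …, u (N - 1)`. -/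
structure Plan (n m p : ℕ) where
  /-- predicted states -/
  x : ℕ → Vec n
  /-- predicted inputs -/
  u : ℕ → Vec m
  /-- artificial equilibrium state -/
  xs : Vec n
  /-- artificial equilibrium input -/
  us : Vec m
  /-- artificial equilibrium output -/
  ys : Vec p

namespace Setup

variable {n m p : ℕ} (P : Setup n m p)

/-- The nonlinear dynamics `f(x,u) = f₀(x) + B u`. -/
def f (x : Vec n) (u : Vec m) : Vec n := P.f₀ x + Matrix.toEuclideanLin P.B u

/-- The Jacobian matrix `A_z` of `f₀` at `z`. -/
def A (z : Vec n) : Matrix (Fin n) (Fin n) ℝ :=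
  Matrix.toEuclideanLin.symm (fderiv ℝ P.f₀ z).toLinearMap

/-- The Jacobian matrix `C_z` of `h₀` at `z`. -/
def C (z : Vec n) : Matrix (Fin p) (Fin n) ℝ :=
  Matrix.toEuclideanLin.symm (fderiv ℝ P.h₀ z).toLinearMap

/-- The offset `e_z = f₀(z) - A_z z`. -/
def e (z : Vec n) : Vec n := P.f₀ z - Matrix.toEuclideanLin (P.A z) z

/-- The offset `r_z = h₀(z) - C_z z`. -/
def r (z : Vec n) : Vec p := P.h₀ z - Matrix.toEuclideanLin (P.C z) z

/-- The dynamics linearized at `z`: `f_z(x,u) = A_z x + B u + e_z`. -/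
def fLin (z x : Vec n) (u : Vec m) : Vec n :=
  Matrix.toEuclideanLin (P.A z) x + Matrix.toEuclideanLin P.B u + P.e z

/-- The output linearized at `z`: `h_z(x,u) = C_z x + D u + r_z`. -/
def hLin (z x : Vec n) (u : Vec m) : Vec p :=
  Matrix.toEuclideanLin (P.C z) x + Matrix.toEuclideanLin P.D u + P.r z

/-- The equilibria of the dynamics linearized at `z`. -/
def ZLin (z : Vec n) : Set (Vec n × Vec m) :=
  {q | q.2 ∈ P.Us ∧ q.1 = P.fLin z q.1 q.2}

/-- The equilibrium outputs of the system linearized at `z`. -/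
def ZyLin (z : Vec n) : Set (Vec p) :=
  {y | ∃ q ∈ P.ZLin z, y = P.hLin z q.1 q.2}

/-- The optimal equilibrium cost `J*_{eq,lin}(z)` of the system linearized at `z`. -/
def JeqLin (z : Vec n) : ℝ :=
  sInf ((fun y => wsq P.S (y - P.yr)) '' P.ZyLin z)

/-- The constraints of the MPC problem at the measured state `x`. -/
structure Feasible (x : Vec n) (v : Plan n m p) : Prop where
  dynamics : ∀ k < P.N, v.x (k + 1) = P.fLin x (v.x k) (v.u k)
  initial : v.x 0 = x
  terminal : v.x P.N = v.xs
  input : ∀ k < P.N, v.u k ∈ P.U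
  equilibrium : (v.xs, v.us) ∈ P.ZLin x
  output : v.ys = P.hLin x v.xs v.us

/-- The cost of the MPC problem. -/
def cost (v : Plan n m p) : ℝ :=
  ∑ k ∈ Finset.range P.N, (wsq P.Q (v.x k - v.xs) + wsq P.R (v.u k - v.us))
    + wsq P.S (v.ys - P.yr)

/-- `v` is an optimal solution of the MPC problem at the measured state `x`. -/
def Optimal (x : Vec n) (v : Plan n m p) : Prop :=
  P.Feasible x v ∧ ∀ w, P.Feasible x w → P.cost v ≤ P.cost w

/-- The optimal cost `J*_N(x)` of the MPC problem; it is only meaningful if the problem is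
feasible at `x`. -/
def JN (x : Vec n) : ℝ := sInf (P.cost '' {v | P.Feasible x v})

/-- The Lyapunov function candidate `V(x) = J*_N(x) - J*_{eq,lin}(x)`. -/
def V (x : Vec n) : ℝ := P.JN x - P.JeqLin x

/-- The state of the nonlinear system after `k` steps, started at `x` under the inputs
`u 0, …, u (k - 1)`. -/
def rollout (x : Vec n) (u : ℕ → Vec m) : ℕ → Vec n
  | 0 => x
  | k + 1 => P.f (rollout x u k) (u k)

/-- The controllability matrix `[B, A_z B, …, A_z^{n-1} B]`. -/
def ctrbMatrix (z : Vec n) : Matrix (Fin n) (Fin n × Fin m) ℝ :=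
  Matrix.of fun i kj => (P.A z ^ (kj.1 : ℕ) * P.B) i kj.2

/-- Standing conventions: `U` is compact, `Us` is convex, compact and contained in the interior
of `U`, and the weights are symmetric and positive definite. -/
structure Standing : Prop where
  compact_U : IsCompact P.U
  convex_Us : Convex ℝ P.Us
  compact_Us : IsCompact P.Us
  Us_subset : P.Us ⊆ interior P.U
  posDef_Q : P.Q.PosDef
  posDef_R : P.R.PosDef
  posDef_S : P.S.PosDef

/-- `f₀` and `h₀` are twice continuously differentiable. -/
def Smooth : Prop := ContDiff ℝ 2 P.f₀ ∧ ContDiff ℝ 2 P.h₀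

/-- Unique steady state: `σ_min [A_z - I, B; C_z, D]` is bounded below by a positive constant,
uniformly in `z`; the matrix has full column rank. -/
def UniqueSteadyState : Prop :=
  ∃ σ : ℝ, 0 < σ ∧ ∀ z, SigmaMinGE (Matrix.fromBlocks (P.A z - 1) P.B (P.C z) P.D) σ

/-- Uniform controllability: the smallest of the `n` singular values of the controllability
matrix (equivalently, of its transpose) is bounded below by a positive constant, uniformly
in `z`. -/
def UniformlyControllable : Prop :=
  ∃ σ : ℝ, 0 < σ ∧ ∀ z, SigmaMinGE (P.ctrbMatrix z).transpose σ

/-- Non-singular dynamics: `σ_min (I - A_z)` is bounded below by a positive constant,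
uniformly in `z`. -/
def NonSingular : Prop :=
  ∃ σ : ℝ, 0 < σ ∧ ∀ z, SigmaMinGE (1 - P.A z) σ

/-- Compact steady-state manifold: one compact set contains the equilibria of all
linearizations. -/
def CompactSteadyStates : Prop :=
  ∃ K : Set (Vec n × Vec m), IsCompact K ∧ ∀ z, P.ZLin z ⊆ K

end Setup

end

end LinTrackMPC

/-! ### Weighted norms, uniform Taylor bounds, bounded right inverses. -/

namespace LinTrackMPC

/-! At an optimal plan, `V` splits as `E₁ + E₂`: the tracking cost, and the suboptimality of the
artificial equilibrium among the equilibria of the current linearization. With `s = √V`, all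
relevant states lie within `O(s)` of each other, so replacing the nonlinear system or one
linearization by another causes errors `O(s²) = O(V)`.

A candidate at the state after `n` steps reuses the remaining inputs and then steers to a new
equilibrium by deadbeat control (`exists_feasible_of_prefix`). The input of the new equilibrium lies
a fraction `μ` of the way from the old artificial input to the optimal one
(`exists_shifted_trajectory`).

Dropping the first `n` stages removes a fixed fraction of `E₁`: deadbeat control from the initial
state bounds `E₁` by a multiple of the squared distance to the equilibrium, and the first stage cost
bounds this distance (`exists_sum_tail_stageCost_le`). By convexity the move by `μ` lowers the
offset cost by at least `μ E₂`. Quadratic growth around the optimum (`exists_optimal_equilibrium`)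
makes the length of the move `O(μ √E₂)`, so it adds only `O(μ² E₂)` to the tracking cost, and a
small `μ` wins. The linearization errors enter the tracking cost squared, as `O(V²)`.

The delicate term is the offset cost, where an output error `O(V)` enters linearly. Its coefficient
is the weighted distance of the output from the setpoint, which is small because both optimal
equilibrium costs and `V` are small; hence the error is an arbitrarily small multiple of `V`
(`exists_offsetCost_sub_JeqLin_le`). -/

open scoped MatrixOrder Matrix.Norms.L2Operator in
theorem exists_wsq_eq_norm_sq {k : ℕ} {M : Matrix (Fin k) (Fin k) ℝ} (hM : M.PosDef) :
    ∃ (T : Vec k →L[ℝ] Vec k) (a : ℝ), 0 < a ∧ (∀ v, wsq M v = ‖T v‖ ^ 2) ∧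
      ∀ v, a * ‖v‖ ≤ ‖T v‖ := by
  obtain ⟨B, hB⟩ := CStarAlgebra.nonneg_iff_eq_star_mul_self.mp hM.posSemidef.nonneg
  rw [Matrix.star_eq_conjTranspose] at hB
  have hw : ∀ v : Vec k, wsq M v = ‖Matrix.toEuclideanLin B v‖ ^ 2 := by
    intro v
    rw [EuclideanSpace.norm_sq_eq]
    unfold wsq
    rw [hB, ← Matrix.mulVec_mulVec, Matrix.dotProduct_mulVec, ← Matrix.mulVec_transpose]
    simp [dotProduct, sq, Matrix.conjTranspose_eq_transpose_of_trivial]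
  have hinj : LinearMap.ker (Matrix.toEuclideanLin B) = ⊥ := by
    rw [LinearMap.ker_eq_bot']
    intro v hv
    by_contra hne
    have h1 : 0 < wsq M v := by
      have := hM.dotProduct_mulVec_pos (x := v.ofLp) (by simpa using hne)
      simpa [wsq] using this
    rw [hw, hv] at h1
    simp at h1
  obtain ⟨K, hK, hanti⟩ := (Matrix.toEuclideanLin B).exists_antilipschitzWith hinj
  refine ⟨(Matrix.toEuclideanLin B).toContinuousLinearMap, (K : ℝ)⁻¹, by positivity, hw, ?_⟩
  intro v
  have h := hanti.le_mul_dist v 0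
  have hK' : (0 : ℝ) < K := by positivity
  simp only [dist_zero_right, map_zero] at h
  rw [inv_mul_le_iff₀ hK']
  exact h

theorem exists_taylor_bound {E F : Type*} [NormedAddCommGroup E] [NormedSpace ℝ E] [ProperSpace E]
    [NormedAddCommGroup F] [NormedSpace ℝ F] {g : E → F} (hg : ContDiff ℝ 2 g) (ρ : ℝ) :
    ∃ L : ℝ, 0 ≤ L ∧ ∀ x ∈ Metric.closedBall (0 : E) ρ, ‖fderiv ℝ g x‖ ≤ L ∧
      ∀ y ∈ Metric.closedBall (0 : E) ρ,
        ‖g y - (g x + fderiv ℝ g x (y - x))‖ ≤ L * ‖y - x‖ ^ 2 := by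
  have hK : IsCompact (Metric.closedBall (0 : E) ρ) := isCompact_closedBall 0 ρ
  have hconv : Convex ℝ (Metric.closedBall (0 : E) ρ) := convex_closedBall 0 ρ
  have hd : ContDiff ℝ 1 (fderiv ℝ g) := hg.fderiv_right (by norm_num)
  obtain ⟨L₁, hL₁⟩ := hK.exists_bound_of_continuousOn hd.continuous.continuousOn
  obtain ⟨L₂, hL₂⟩ := hK.exists_bound_of_continuousOn
    (hd.continuous_fderiv (by norm_num)).continuousOn
  have hlip : ∀ x ∈ Metric.closedBall (0 : E) ρ, ∀ y ∈ Metric.closedBall (0 : E) ρ,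
      ‖fderiv ℝ g y - fderiv ℝ g x‖ ≤ L₂ * ‖y - x‖ := fun x hx y hy =>
    hconv.norm_image_sub_le_of_norm_fderiv_le
      (fun w _ => (hd.differentiable (by norm_num)).differentiableAt) hL₂ hx hy
  refine ⟨max 0 (max L₁ L₂), le_max_left _ _, fun x hx => ⟨(hL₁ x hx).trans (by simp), ?_⟩⟩
  intro y hy
  have hseg : segment ℝ x y ⊆ Metric.closedBall (0 : E) ρ := hconv.segment_subset hx hy
  have h := (convex_segment (𝕜 := ℝ) x y).norm_image_sub_le_of_norm_fderiv_le'
    (f := g) (φ := fderiv ℝ g x) (C := max 0 (max L₁ L₂) * ‖y - x‖) (x := x) (y := y)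
    (fun w _ => (hg.differentiable (by norm_num)).differentiableAt) ?_
    (left_mem_segment ℝ x y) (right_mem_segment ℝ x y)
  · rw [← sub_sub, sq, ← mul_assoc]
    exact h
  · intro w hw
    refine (hlip x hx w (hseg hw)).trans ?_
    have h1 : ‖w - x‖ ≤ ‖y - x‖ := norm_sub_le_of_mem_segment hw
    gcongr
    simp

/-- Take `w = T v` with `T* T v = b`; then `‖w‖² = ⟨b, v⟩ ≤ σ⁻¹ ‖b‖ ‖w‖`. With `T` the transposed
controllability matrix this yields steering inputs of uniformly bounded gain. -/
theorem exists_adjoint_eq_of_le_norm {E F : Type*} [NormedAddCommGroup E] [InnerProductSpace ℝ E]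
    [FiniteDimensional ℝ E] [NormedAddCommGroup F] [InnerProductSpace ℝ F]
    [FiniteDimensional ℝ F] (T : E →ₗ[ℝ] F) {σ : ℝ} (hσ : 0 < σ)
    (hT : ∀ v, σ * ‖v‖ ≤ ‖T v‖) (b : E) :
    ∃ w : F, LinearMap.adjoint T w = b ∧ ‖w‖ ≤ σ⁻¹ * ‖b‖ := by
  have hinj : Function.Injective (LinearMap.adjoint T ∘ₗ T) := by
    rw [injective_iff_map_eq_zero]
    intro v hv
    have h1 : ‖T v‖ ^ 2 = 0 := by
      rw [← real_inner_self_eq_norm_sq, ← LinearMap.adjoint_inner_left]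
      have : LinearMap.adjoint T (T v) = 0 := hv
      simp [this]
    have h2 : ‖T v‖ = 0 := by simpa using h1
    have h3 := hT v
    rw [h2] at h3
    have : ‖v‖ ≤ 0 := by
      by_contra h
      push Not at h
      nlinarith [mul_pos hσ h]
    simpa using this
  obtain ⟨v, hv⟩ := LinearMap.injective_iff_surjective.mp hinj b
  refine ⟨T v, hv, ?_⟩
  have h1 : ‖T v‖ ^ 2 = inner ℝ b v := by
    rw [← real_inner_self_eq_norm_sq, ← LinearMap.adjoint_inner_left, ← hv]
    rfl
  have h2 : ‖T v‖ ^ 2 ≤ ‖b‖ * ‖v‖ := h1 ▸ real_inner_le_norm b v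
  have h3 : ‖v‖ ≤ σ⁻¹ * ‖T v‖ := by
    rw [le_inv_mul_iff₀ hσ]; exact hT v
  by_contra h
  push Not at h
  have h4 : 0 < ‖T v‖ := lt_of_le_of_lt (by positivity) h
  have h5 : ‖T v‖ ^ 2 ≤ (σ⁻¹ * ‖b‖) * ‖T v‖ := by
    calc _ ≤ ‖b‖ * ‖v‖ := h2
      _ ≤ ‖b‖ * (σ⁻¹ * ‖T v‖) := by gcongr
      _ = _ := by ring
  nlinarith

/-! ### The rank hypotheses as estimates on derivatives. -/

namespace Setup

variable {n m p : ℕ} (P : Setup n m p)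

theorem toEuclideanLin_A (z x : Vec n) : Matrix.toEuclideanLin (P.A z) x = fderiv ℝ P.f₀ z x := by
  simp [A]

theorem toEuclideanLin_C (z x : Vec n) : Matrix.toEuclideanLin (P.C z) x = fderiv ℝ P.h₀ z x := by
  simp [C]

theorem fLin_eq (z x : Vec n) (u : Vec m) :
    P.fLin z x u = P.f₀ z + fderiv ℝ P.f₀ z (x - z) + Matrix.toEuclideanLin P.B u := by
  simp only [fLin, e, toEuclideanLin_A, map_sub]
  abel

theorem hLin_eq (z x : Vec n) (u : Vec m) :
    P.hLin z x u = P.h₀ z + fderiv ℝ P.h₀ z (x - z) + Matrix.toEuclideanLin P.D u := by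
  simp only [hLin, r, toEuclideanLin_C, map_sub]
  abel

theorem fLin_sub_fLin (z x x' : Vec n) (u u' : Vec m) :
    P.fLin z x u - P.fLin z x' u'
      = fderiv ℝ P.f₀ z (x - x') + Matrix.toEuclideanLin P.B (u - u') := by
  simp only [fLin_eq, map_sub]
  abel

theorem hLin_sub_hLin (z x x' : Vec n) (u u' : Vec m) :
    P.hLin z x u - P.hLin z x' u'
      = fderiv ℝ P.h₀ z (x - x') + Matrix.toEuclideanLin P.D (u - u') := by
  simp only [hLin_eq, map_sub]
  abel

variable {P}

theorem NonSingular.exists_le_norm (h : P.NonSingular) :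
    ∃ σ : ℝ, 0 < σ ∧ ∀ z v, σ * ‖v‖ ≤ ‖v - fderiv ℝ P.f₀ z v‖ := by
  obtain ⟨σ, hσ, h⟩ := h
  refine ⟨σ, hσ, fun z v => ?_⟩
  have := (sigmaMinGE_iff _ hσ.le).mp (h z) v
  rwa [map_sub, LinearMap.sub_apply, toEuclideanLin_A, Matrix.toLpLin_one] at this

/-- On differences of equilibria the upper block row of the matrix vanishes, so its lower bound
passes entirely to the output row. -/
theorem UniqueSteadyState.exists_le_norm (h : P.UniqueSteadyState) :
    ∃ σ : ℝ, 0 < σ ∧ ∀ z (v : Vec n) (w : Vec m),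
      v = fderiv ℝ P.f₀ z v + Matrix.toEuclideanLin P.B w →
      σ * ‖v‖ ≤ ‖fderiv ℝ P.h₀ z v + Matrix.toEuclideanLin P.D w‖ ∧
      σ * ‖w‖ ≤ ‖fderiv ℝ P.h₀ z v + Matrix.toEuclideanLin P.D w‖ := by
  obtain ⟨σ, hσ, h⟩ := h
  refine ⟨σ, hσ, fun z v w hvw => ?_⟩
  have key := (sigmaMinGE_iff _ hσ.le).mp (h z) (WithLp.toLp 2 (Sum.elim v.ofLp w.ofLp))
  have h0 : (P.A z - 1).mulVec v.ofLp + P.B.mulVec w.ofLp = 0 := by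
    have h1 : Matrix.toEuclideanLin (P.A z) v - v + Matrix.toEuclideanLin P.B w = 0 := by
      rw [toEuclideanLin_A]
      nth_rewrite 2 [hvw]
      abel
    have h2 := congrArg WithLp.ofLp h1
    simpa [Matrix.sub_mulVec, Matrix.toLpLin_apply] using h2
  have hR : ‖Matrix.toEuclideanLin (Matrix.fromBlocks (P.A z - 1) P.B (P.C z) P.D)
      (WithLp.toLp 2 (Sum.elim v.ofLp w.ofLp))‖
      = ‖fderiv ℝ P.h₀ z v + Matrix.toEuclideanLin P.D w‖ := by
    rw [EuclideanSpace.norm_eq, EuclideanSpace.norm_eq, ← toEuclideanLin_C]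
    congr 1
    simp only [Matrix.toLpLin_apply, Matrix.fromBlocks_mulVec, Fintype.sum_sum_type]
    simp [h0, Function.comp_def]
  rw [hR] at key
  have hv : ‖v‖ ≤ ‖(WithLp.toLp 2 (Sum.elim v.ofLp w.ofLp) : EuclideanSpace ℝ (Fin n ⊕ Fin m))‖ := by
    rw [EuclideanSpace.norm_eq, EuclideanSpace.norm_eq]
    apply Real.sqrt_le_sqrt
    simp only [Fintype.sum_sum_type, Sum.elim_inl, Sum.elim_inr]
    linarith [Finset.sum_nonneg (s := Finset.univ) fun i (_ : i ∈ Finset.univ) => sq_nonneg ‖w i‖]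
  have hw : ‖w‖ ≤ ‖(WithLp.toLp 2 (Sum.elim v.ofLp w.ofLp) : EuclideanSpace ℝ (Fin n ⊕ Fin m))‖ := by
    rw [EuclideanSpace.norm_eq, EuclideanSpace.norm_eq]
    apply Real.sqrt_le_sqrt
    simp only [Fintype.sum_sum_type, Sum.elim_inl, Sum.elim_inr]
    linarith [Finset.sum_nonneg (s := Finset.univ) fun i (_ : i ∈ Finset.univ) => sq_nonneg ‖v i‖]
  exact ⟨le_trans (by gcongr) key, le_trans (by gcongr) key⟩

theorem UniformlyControllable.exists_preimage (h : P.UniformlyControllable) :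
    ∃ c : ℝ, 0 < c ∧ ∀ z (b : Vec n), ∃ w : ℕ → Vec m, (∀ k, ‖w k‖ ≤ c * ‖b‖) ∧
      ∑ k ∈ Finset.range n, (fderiv ℝ P.f₀ z ^ k) (Matrix.toEuclideanLin P.B (w k)) = b := by
  obtain ⟨σ, hσ, h⟩ := h
  refine ⟨σ⁻¹, by positivity, fun z b => ?_⟩
  obtain ⟨w, hw, hwb⟩ := exists_adjoint_eq_of_le_norm _ hσ
    ((sigmaMinGE_iff _ hσ.le).mp (h z)) b
  refine ⟨fun k => if hk : k < n then WithLp.toLp 2 fun j => w (⟨k, hk⟩, j) else 0, ?_, ?_⟩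
  · intro k
    by_cases hk : k < n
    · simp only [hk, dif_pos]
      refine le_trans ?_ hwb
      rw [EuclideanSpace.norm_eq, EuclideanSpace.norm_eq]
      apply Real.sqrt_le_sqrt
      rw [Fintype.sum_prod_type]
      exact Finset.single_le_sum (f := fun i : Fin n => ∑ j, ‖w (i, j)‖ ^ 2)
        (fun i _ => by positivity) (Finset.mem_univ (⟨k, hk⟩ : Fin n))
    · simp only [hk, dif_neg, not_false_eq_true, norm_zero]
      positivity
  · have hpow : ∀ (k : ℕ) (x : Vec n),
        (fderiv ℝ P.f₀ z ^ k) x = Matrix.toEuclideanLin (P.A z ^ k) x := by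
      intro k
      induction k with
      | zero => intro x; simp
      | succ k ih =>
        intro x
        rw [pow_succ, pow_succ, mul_apply_eq_comp, ih, ← toEuclideanLin_A]
        simp [Matrix.toLpLin_apply]
    have hadj : LinearMap.adjoint (Matrix.toEuclideanLin (P.ctrbMatrix z).transpose)
        = Matrix.toEuclideanLin (P.ctrbMatrix z) := by
      rw [← Matrix.conjTranspose_eq_transpose_of_trivial,
        Matrix.toEuclideanLin_conjTranspose_eq_adjoint, LinearMap.adjoint_adjoint]
    rw [hadj] at hw
    rw [← hw, Finset.sum_range]
    ext i
    simp only [Fin.is_lt, dif_pos, Fin.eta, hpow, WithLp.ofLp_sum, Finset.sum_apply]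
    simp only [Matrix.toLpLin_apply, Matrix.mulVec_mulVec]
    simp only [Matrix.mulVec, dotProduct, ctrbMatrix, Matrix.of_apply]
    rw [Fintype.sum_prod_type]

end Setup

/-! ### Uniform constants and deadbeat control. -/

namespace Setup

variable {n m p : ℕ}

/-- Uniform constants extracted from the hypotheses: `L` bounds everything from above and `a`
everything from below, on the ball of radius `ρ`, which contains the `3`-neighbourhood of all
equilibria. -/
structure Estimates (P : Setup n m p) where
  /-- upper constant -/
  L : ℝ
  /-- lower constant -/
  a : ℝ
  /-- radius of the region of interest -/
  ρ : ℝ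
  /-- square root of `Q` -/
  TQ : Vec n →L[ℝ] Vec n
  /-- square root of `R` -/
  TR : Vec m →L[ℝ] Vec m
  /-- square root of `S` -/
  TS : Vec p →L[ℝ] Vec p
  one_le_L : 1 ≤ L
  a_pos : 0 < a
  a_le_one : a ≤ 1
  norm_fderiv_f : ∀ z, ‖z‖ ≤ ρ → ∀ v, ‖fderiv ℝ P.f₀ z v‖ ≤ L * ‖v‖
  norm_fderiv_h : ∀ z, ‖z‖ ≤ ρ → ∀ v, ‖fderiv ℝ P.h₀ z v‖ ≤ L * ‖v‖
  taylor_f : ∀ z x, ‖z‖ ≤ ρ → ‖x‖ ≤ ρ →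
    ‖P.f₀ x - (P.f₀ z + fderiv ℝ P.f₀ z (x - z))‖ ≤ L * ‖x - z‖ ^ 2
  taylor_h : ∀ z x, ‖z‖ ≤ ρ → ‖x‖ ≤ ρ →
    ‖P.h₀ x - (P.h₀ z + fderiv ℝ P.h₀ z (x - z))‖ ≤ L * ‖x - z‖ ^ 2
  norm_B : ∀ u, ‖Matrix.toEuclideanLin P.B u‖ ≤ L * ‖u‖
  nonsing : ∀ z v, a * ‖v‖ ≤ ‖v - fderiv ℝ P.f₀ z v‖
  unique : ∀ z (v : Vec n) (w : Vec m), v = fderiv ℝ P.f₀ z v + Matrix.toEuclideanLin P.B w →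
    a * ‖v‖ ≤ ‖fderiv ℝ P.h₀ z v + Matrix.toEuclideanLin P.D w‖ ∧
    a * ‖w‖ ≤ ‖fderiv ℝ P.h₀ z v + Matrix.toEuclideanLin P.D w‖
  ctrb : ∀ z (b : Vec n), ∃ w : ℕ → Vec m, (∀ k, ‖w k‖ ≤ L * ‖b‖) ∧
      ∑ k ∈ Finset.range n, (fderiv ℝ P.f₀ z ^ k) (Matrix.toEuclideanLin P.B (w k)) = b
  wsq_Q : ∀ v, wsq P.Q v = ‖TQ v‖ ^ 2
  wsq_R : ∀ v, wsq P.R v = ‖TR v‖ ^ 2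
  wsq_S : ∀ v, wsq P.S v = ‖TS v‖ ^ 2
  le_TQ : ∀ v, a * ‖v‖ ≤ ‖TQ v‖
  le_TR : ∀ v, a * ‖v‖ ≤ ‖TR v‖
  le_TS : ∀ v, a * ‖v‖ ≤ ‖TS v‖
  TQ_le : ∀ v, ‖TQ v‖ ≤ L * ‖v‖
  TR_le : ∀ v, ‖TR v‖ ≤ L * ‖v‖
  TS_le : ∀ v, ‖TS v‖ ≤ L * ‖v‖
  norm_eq_le : ∀ z, ∀ q ∈ P.ZLin z, ‖q.1‖ ≤ ρ - 3
  margin : ∀ u ∈ P.Us, ∀ w, ‖w‖ ≤ a → u + w ∈ P.U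

theorem nonempty_estimates {P : Setup n m p} (hstanding : P.Standing) (hsmooth : P.Smooth)
    (hunique : P.UniqueSteadyState) (hctrb : P.UniformlyControllable)
    (hnonsing : P.NonSingular) (hcompact : P.CompactSteadyStates) : Nonempty P.Estimates := by
  obtain ⟨TQ, aQ, haQ, hwQ, hQ⟩ := exists_wsq_eq_norm_sq hstanding.posDef_Q
  obtain ⟨TR, aR, haR, hwR, hR⟩ := exists_wsq_eq_norm_sq hstanding.posDef_R
  obtain ⟨TS, aS, haS, hwS, hS⟩ := exists_wsq_eq_norm_sq hstanding.posDef_S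
  obtain ⟨σu, hσu, hu⟩ := hunique.exists_le_norm
  obtain ⟨σn, hσn, hn⟩ := hnonsing.exists_le_norm
  obtain ⟨c, hc, hcb⟩ := hctrb.exists_preimage
  obtain ⟨K, hK, hKZ⟩ := hcompact
  obtain ⟨r, hr⟩ := hK.isBounded.exists_norm_le
  -- States of a cheap plan stay within 1 of its equilibrium, and the nonlinear trajectory within 1
  -- of those states; radius `r + 3` covers both with room to spare.
  obtain ⟨Lf, hLf0, hLf⟩ := exists_taylor_bound hsmooth.1 (r + 3)
  obtain ⟨Lh, hLh0, hLh⟩ := exists_taylor_bound hsmooth.2 (r + 3)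
  obtain ⟨δ, hδ, hδU⟩ := hstanding.compact_Us.exists_cthickening_subset_open isOpen_interior
    hstanding.Us_subset
  set Bc := (Matrix.toEuclideanLin P.B).toContinuousLinearMap
  obtain ⟨L, hL1, hLc, hLLf, hLLh, hLB, hLQ, hLR, hLS⟩ : ∃ L : ℝ, 1 ≤ L ∧ c ≤ L ∧ Lf ≤ L ∧
      Lh ≤ L ∧ ‖Bc‖ ≤ L ∧ ‖TQ‖ ≤ L ∧ ‖TR‖ ≤ L ∧ ‖TS‖ ≤ L :=
    ⟨max 1 (max c (max Lf (max Lh (max ‖Bc‖ (max ‖TQ‖ (max ‖TR‖ ‖TS‖)))))), by simp⟩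
  obtain ⟨a, ha0, hale, ha1, ha2, ha3, ha4, ha5, ha6⟩ : ∃ a : ℝ, 0 < a ∧ a ≤ 1 ∧ a ≤ aQ ∧
      a ≤ aR ∧ a ≤ aS ∧ a ≤ σu ∧ a ≤ σn ∧ a ≤ δ :=
    ⟨min 1 (min aQ (min aR (min aS (min σu (min σn δ))))),
      lt_min one_pos (lt_min haQ (lt_min haR (lt_min haS (lt_min hσu (lt_min hσn hδ))))), by simp⟩
  refine ⟨{ L := L, a := a, ρ := r + 3, TQ := TQ, TR := TR, TS := TS
            one_le_L := hL1
            a_pos := ha0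
            a_le_one := hale
            norm_fderiv_f := ?_, norm_fderiv_h := ?_, taylor_f := ?_, taylor_h := ?_,
            norm_B := ?_, nonsing := ?_, unique := ?_, ctrb := ?_
            wsq_Q := hwQ, wsq_R := hwR, wsq_S := hwS
            le_TQ := fun v => le_trans (by gcongr) (hQ v)
            le_TR := fun v => le_trans (by gcongr) (hR v)
            le_TS := fun v => le_trans (by gcongr) (hS v)
            TQ_le := fun v => TQ.le_of_opNorm_le hLQ v
            TR_le := fun v => TR.le_of_opNorm_le hLR v
            TS_le := fun v => TS.le_of_opNorm_le hLS v
            norm_eq_le := ?_, margin := ?_ }⟩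
  · intro z hz v
    exact (fderiv ℝ P.f₀ z).le_of_opNorm_le (((hLf z (by simpa using hz)).1).trans hLLf) v
  · intro z hz v
    exact (fderiv ℝ P.h₀ z).le_of_opNorm_le (((hLh z (by simpa using hz)).1).trans hLLh) v
  · intro z x hz hx
    exact ((hLf z (by simpa using hz)).2 x (by simpa using hx)).trans (by gcongr)
  · intro z x hz hx
    exact ((hLh z (by simpa using hz)).2 x (by simpa using hx)).trans (by gcongr)
  · intro u
    exact Bc.le_of_opNorm_le hLB u
  · intro z v
    exact le_trans (by gcongr) (hn z v)
  · intro z v w h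
    exact ⟨le_trans (by gcongr) (hu z v w h).1, le_trans (by gcongr) (hu z v w h).2⟩
  · intro z b
    obtain ⟨w, hw, hwb⟩ := hcb z b
    exact ⟨w, fun k => (hw k).trans (by gcongr), hwb⟩
  · intro z q hq
    have := (norm_fst_le q).trans (hr q (hKZ z hq))
    linarith
  · intro u huU w hw
    refine interior_subset (hδU (Metric.mem_cthickening_of_dist_le (u + w) u δ _ huU ?_))
    rw [dist_eq_norm, add_sub_cancel_left]
    exact hw.trans ha6

/-- The part of the MPC cost that penalizes the distance to the artificial equilibrium. -/
noncomputable def trackCost (P : Setup n m p) (v : Plan n m p) : ℝ :=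
  ∑ k ∈ Finset.range P.N, (wsq P.Q (v.x k - v.xs) + wsq P.R (v.u k - v.us))

/-- The cost of the equilibrium `q` of the dynamics linearized at `z`. -/
noncomputable def offsetCost (P : Setup n m p) (z : Vec n) (q : Vec n × Vec m) : ℝ :=
  wsq P.S (P.hLin z q.1 q.2 - P.yr)

namespace Estimates

variable {P : Setup n m p} (H : P.Estimates)

-- Here `δ` is a deviation from an equilibrium, so the affine offset drops out. By variation of
-- constants, reaching zero at time `n` means solving the controllability equation with right-hand
-- side `-A ^ n δ₀`.
include H in
theorem exists_deadbeat : ∃ G : ℝ, 0 ≤ G ∧ ∀ z, ‖z‖ ≤ H.ρ → ∀ δ₀ : Vec n,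
    ∃ (δ : ℕ → Vec n) (w : ℕ → Vec m), δ 0 = δ₀ ∧
      (∀ k, δ (k + 1) = fderiv ℝ P.f₀ z (δ k) + Matrix.toEuclideanLin P.B (w k)) ∧
      (∀ k, n ≤ k → δ k = 0) ∧ (∀ k, n ≤ k → w k = 0) ∧
      (∀ k, ‖δ k‖ ≤ G * ‖δ₀‖) ∧ (∀ k, ‖w k‖ ≤ G * ‖δ₀‖) := by
  have hL := H.one_le_L
  set c := H.L * H.L ^ n with hc
  have hc0 : 0 ≤ c := by positivity
  have hg : 1 ≤ H.L + H.L * c := by nlinarith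
  refine ⟨(H.L + H.L * c) ^ n + c, by positivity, fun z hz δ₀ => ?_⟩
  set A := fderiv ℝ P.f₀ z
  have hApow : ∀ k v, ‖(A ^ k) v‖ ≤ H.L ^ k * ‖v‖ := by
    intro k
    induction k with
    | zero => intro v; simp
    | succ k ih =>
      intro v
      rw [pow_succ', mul_apply_eq_comp, pow_succ', mul_assoc]
      exact (H.norm_fderiv_f z hz _).trans (by gcongr; exact ih v)
  obtain ⟨w, hw, hwb⟩ := H.ctrb z (-(A ^ n) δ₀)
  have hw' : ∀ k, ‖w k‖ ≤ c * ‖δ₀‖ := fun k => by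
    refine (hw k).trans ?_
    rw [norm_neg, hc, mul_assoc]
    gcongr
    exact hApow n δ₀
  -- Time reversal: the input at time `j` reaches time `n` through `A ^ (n - 1 - j)`. Zero inputs
  -- from time `n` on keep the deviation at zero.
  let u : ℕ → Vec m := fun j => if j < n then w (n - 1 - j) else 0
  have hu : ∀ k, ‖u k‖ ≤ c * ‖δ₀‖ := fun k => by
    by_cases hk : k < n
    · simpa [u, hk] using hw' _
    · simp only [u, hk, if_false, norm_zero]; positivity
  let δ : ℕ → Vec n := fun k => Nat.rec δ₀ (fun k d => A d + Matrix.toEuclideanLin P.B (u k)) k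
  have hδ : ∀ k, δ (k + 1) = A (δ k) + Matrix.toEuclideanLin P.B (u k) := fun k => rfl
  have hformula : ∀ k, δ k = (A ^ k) δ₀ + ∑ j ∈ Finset.range k,
      (A ^ (k - 1 - j)) (Matrix.toEuclideanLin P.B (u j)) := by
    intro k
    induction k with
    | zero => simp [δ]
    | succ k ih =>
      rw [hδ, ih, map_add, map_sum, Finset.sum_range_succ, pow_succ', mul_apply_eq_comp, add_assoc]
      congr 2
      · refine Finset.sum_congr rfl fun j hj => ?_
        have hj' : k + 1 - 1 - j = (k - 1 - j) + 1 := by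
          have := Finset.mem_range.mp hj; omega
        rw [hj', pow_succ', mul_apply_eq_comp]
      · simp
  have hzero : ∀ k, δ (n + k) = 0 := by
    intro k
    induction k with
    | zero =>
      rw [add_zero, hformula]
      have hrefl := Finset.sum_range_reflect
        (fun k => (A ^ k) (Matrix.toEuclideanLin P.B (w k))) n
      rw [hwb] at hrefl
      have : ∑ j ∈ Finset.range n, (A ^ (n - 1 - j)) (Matrix.toEuclideanLin P.B (u j))
          = -(A ^ n) δ₀ := by
        rw [← hrefl]
        refine Finset.sum_congr rfl fun j hj => ?_
        simp [u, Finset.mem_range.mp hj]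
      rw [this, add_neg_cancel]
    | succ k ih =>
      rw [← add_assoc, hδ, ih]
      simp [u]
  have hgrow : ∀ k, ‖δ k‖ ≤ (H.L + H.L * c) ^ k * ‖δ₀‖ := by
    intro k
    induction k with
    | zero => simp [δ]
    | succ k ih =>
      rw [hδ]
      have h1 : 1 ≤ (H.L + H.L * c) ^ k := one_le_pow₀ hg
      calc _ ≤ H.L * ‖δ k‖ + H.L * ‖u k‖ :=
            (norm_add_le _ _).trans (add_le_add (H.norm_fderiv_f z hz _) (H.norm_B _))
        _ ≤ H.L * ((H.L + H.L * c) ^ k * ‖δ₀‖) + H.L * (c * ‖δ₀‖) := by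
            gcongr; exact hu k
        _ ≤ H.L * ((H.L + H.L * c) ^ k * ‖δ₀‖) + H.L * (c * ((H.L + H.L * c) ^ k * ‖δ₀‖)) := by
            gcongr; nlinarith [norm_nonneg δ₀]
        _ = _ := by ring
  have hx : 0 ≤ ‖δ₀‖ := norm_nonneg _
  refine ⟨δ, u, rfl, hδ, ?_, ?_, ?_, ?_⟩
  · intro k hk
    obtain ⟨j, rfl⟩ := Nat.exists_eq_add_of_le hk
    exact hzero j
  · intro k hk
    simp [u, not_lt.mpr hk]
  · intro k
    by_cases hk : k ≤ n
    · calc _ ≤ _ := hgrow k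
        _ ≤ ((H.L + H.L * c) ^ n + c) * ‖δ₀‖ := by
          gcongr
          have := pow_le_pow_right₀ hg hk
          linarith
    · obtain ⟨j, rfl⟩ := Nat.exists_eq_add_of_le (not_le.mp hk).le
      rw [hzero, norm_zero]; positivity
  · intro k
    refine (hu k).trans ?_
    gcongr
    have : 0 ≤ (H.L + H.L * c) ^ n := by positivity
    linarith

include H in
/-- A trajectory of the linearization that ends close to an equilibrium can be continued by a
deadbeat controller to a candidate solution of the MPC problem. -/
theorem exists_feasible_of_prefix : ∃ G r : ℝ, 0 ≤ G ∧ 0 < r ∧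
    ∀ z, ‖z‖ ≤ H.ρ → ∀ q ∈ P.ZLin z, ∀ K, K + n ≤ P.N → ∀ (x : ℕ → Vec n) (u : ℕ → Vec m),
      x 0 = z → (∀ k < K, x (k + 1) = P.fLin z (x k) (u k)) → (∀ k < K, u k ∈ P.U) →
      ‖x K - q.1‖ ≤ r →
      ∃ w, P.Feasible z w ∧ w.xs = q.1 ∧ w.us = q.2 ∧
        P.trackCost w ≤ ∑ k ∈ Finset.range K, (wsq P.Q (x k - q.1) + wsq P.R (u k - q.2))
          + G * ‖x K - q.1‖ ^ 2 := by
  obtain ⟨G, hG, hdb⟩ := H.exists_deadbeat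
  have ha := H.a_pos
  have hL := H.one_le_L
  -- The radius keeps the deadbeat corrections below the margin `a` between `Us` and the complement
  -- of `U`; the constant counts at most `N` deadbeat stages.
  refine ⟨P.N * (2 * (H.L * G) ^ 2), H.a / (G + 1), by positivity, by positivity, ?_⟩
  intro z hz q hq K hK x u hx0 hx hu hr
  obtain ⟨δ, w, hδ0, hδ, hδn, hwn, hδG, hwG⟩ := hdb z hz (x K - q.1)
  have hwa : ∀ k, ‖w k‖ ≤ H.a := fun k => by
    refine (hwG k).trans ?_
    calc G * ‖x K - q.1‖ ≤ (G + 1) * (H.a / (G + 1)) := by gcongr; linarith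
      _ = H.a := by field_simp
  let X : ℕ → Vec n := fun k => if k < K then x k else q.1 + δ (k - K)
  let W : ℕ → Vec m := fun k => if k < K then u k else q.2 + w (k - K)
  -- The case `k = K` is included because `δ 0 = x K - q.1`; it makes the two pieces fit together.
  have hXle : ∀ k ≤ K, X k = x k := by
    intro k hk
    rcases hk.lt_or_eq with h | rfl
    · simp [X, h]
    · simp [X, hδ0]
  refine ⟨⟨X, W, q.1, q.2, P.hLin z q.1 q.2⟩, ⟨?_, ?_, ?_, ?_, hq, rfl⟩, rfl, rfl, ?_⟩
  · intro k _
    change X (k + 1) = P.fLin z (X k) (W k)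
    by_cases hk : k < K
    · rw [hXle _ hk, hXle _ hk.le, hx k hk]
      simp [W, hk]
    · have h1 : ¬ (k + 1 < K) := by omega
      have h2 : k + 1 - K = k - K + 1 := by omega
      have h3 := P.fLin_sub_fLin z (q.1 + δ (k - K)) q.1 (q.2 + w (k - K)) q.2
      simp only [X, W, hk, h1, if_false, h2, hδ]
      rw [add_sub_cancel_left, add_sub_cancel_left, ← hq.2, sub_eq_iff_eq_add'] at h3
      exact h3.symm
  · change X 0 = z
    rw [hXle 0 (Nat.zero_le _), hx0]
  · change X P.N = q.1
    have h1 : ¬ (P.N < K) := by omega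
    simp [X, h1, hδn (P.N - K) (by omega)]
  · intro k _
    change W k ∈ P.U
    by_cases hk : k < K
    · simpa [W, hk] using hu k hk
    · simpa [W, hk] using H.margin q.2 hq.1 _ (hwa _)
  · change ∑ k ∈ Finset.range P.N, (wsq P.Q (X k - q.1) + wsq P.R (W k - q.2)) ≤ _
    rw [← Finset.sum_range_add_sum_Ico _ (show K ≤ P.N by omega)]
    refine add_le_add (le_of_eq (Finset.sum_congr rfl fun k hk => ?_)) ?_
    · simp [X, W, Finset.mem_range.mp hk]
    · calc _ ≤ ∑ k ∈ Finset.Ico K P.N, 2 * (H.L * G) ^ 2 * ‖x K - q.1‖ ^ 2 := by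
            refine Finset.sum_le_sum fun k hk => ?_
            have hk' : ¬ (k < K) := not_lt.mpr (Finset.mem_Ico.mp hk).1
            simp only [X, W, hk', if_false, add_sub_cancel_left, H.wsq_Q, H.wsq_R]
            have h1 : ‖H.TQ (δ (k - K))‖ ≤ H.L * (G * ‖x K - q.1‖) :=
              (H.TQ_le _).trans (by gcongr; exact hδG _)
            have h2 : ‖H.TR (w (k - K))‖ ≤ H.L * (G * ‖x K - q.1‖) :=
              (H.TR_le _).trans (by gcongr; exact hwG _)
            have h3 := pow_le_pow_left₀ (norm_nonneg _) h1 2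
            have h4 := pow_le_pow_left₀ (norm_nonneg _) h2 2
            calc _ ≤ _ := add_le_add h3 h4
              _ = _ := by ring
        _ = (P.N - K : ℕ) * (2 * (H.L * G) ^ 2 * ‖x K - q.1‖ ^ 2) := by simp
        _ ≤ P.N * (2 * (H.L * G) ^ 2 * ‖x K - q.1‖ ^ 2) := by
            gcongr; omega
        _ = _ := by ring

end Estimates

end Setup

/-! ### Convexity, perturbation and quadratic growth for equilibria. -/

theorem norm_convexCombination_sq_le {E : Type*} [NormedAddCommGroup E] [InnerProductSpace ℝ E]
    (x y : E) {t : ℝ} (h0 : 0 ≤ t) (h1 : t ≤ 1) :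
    ‖(1 - t) • x + t • y‖ ^ 2 ≤ (1 - t) * ‖x‖ ^ 2 + t * ‖y‖ ^ 2 := by
  have h : ‖(1 - t) • x + t • y‖ ≤ (1 - t) * ‖x‖ + t * ‖y‖ := by
    refine (norm_add_le _ _).trans (le_of_eq ?_)
    rw [norm_smul, norm_smul, Real.norm_of_nonneg h0, Real.norm_of_nonneg (sub_nonneg.mpr h1)]
  refine (pow_le_pow_left₀ (norm_nonneg _) h 2).trans ?_
  nlinarith [mul_nonneg (mul_nonneg h0 (sub_nonneg.mpr h1)) (sq_nonneg (‖x‖ - ‖y‖))]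

/-- First-order optimality along a segment: for small `t` the linear term dominates. -/
theorem nonneg_of_forall_quadratic_nonneg {b c : ℝ} (hc : 0 ≤ c)
    (h : ∀ t, 0 < t → t ≤ 1 → 0 ≤ 2 * t * b + t ^ 2 * c) : 0 ≤ b := by
  by_contra hb
  push Not at hb
  set t := min 1 (-b / (c + 1))
  have ht : 0 < t := lt_min one_pos (div_pos (by linarith) (by linarith))
  have h1 := h t ht (min_le_left _ _)
  have h2 : t * (c + 1) ≤ -b := by
    rw [← le_div_iff₀ (by linarith)]
    exact min_le_right _ _
  nlinarith

namespace Setup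

variable {n m p : ℕ} {P : Setup n m p}

theorem hLin_convexCombination (z : Vec n) (q q' : Vec n × Vec m) (t : ℝ) :
    P.hLin z ((1 - t) • q + t • q').1 ((1 - t) • q + t • q').2
      = (1 - t) • P.hLin z q.1 q.2 + t • P.hLin z q'.1 q'.2 := by
  simp only [hLin, Prod.fst_add, Prod.snd_add, Prod.smul_fst, Prod.smul_snd, map_add, map_smul]
  module

theorem fLin_convexCombination (z : Vec n) (q q' : Vec n × Vec m) (t : ℝ) :
    P.fLin z ((1 - t) • q + t • q').1 ((1 - t) • q + t • q').2
      = (1 - t) • P.fLin z q.1 q.2 + t • P.fLin z q'.1 q'.2 := by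
  simp only [fLin, Prod.fst_add, Prod.snd_add, Prod.smul_fst, Prod.smul_snd, map_add, map_smul]
  module

theorem convexCombination_mem_ZLin (hconv : Convex ℝ P.Us) {z : Vec n} {q q' : Vec n × Vec m}
    (hq : q ∈ P.ZLin z) (hq' : q' ∈ P.ZLin z) {t : ℝ} (h0 : 0 ≤ t) (h1 : t ≤ 1) :
    (1 - t) • q + t • q' ∈ P.ZLin z := by
  refine ⟨hconv hq.1 hq'.1 (sub_nonneg.mpr h1) h0 (by ring), ?_⟩
  rw [fLin_convexCombination, ← hq.2, ← hq'.2]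
  rfl

namespace Estimates

variable (H : P.Estimates)

include H

/-- Both linearizations are compared with the nonlinear value at `x`, which cancels and leaves two
Taylor remainders. -/
theorem norm_fLin_sub_le {z z' x : Vec n} (hz : ‖z‖ ≤ H.ρ) (hz' : ‖z'‖ ≤ H.ρ) (hx : ‖x‖ ≤ H.ρ)
    (u : Vec m) : ‖P.fLin z' x u - P.fLin z x u‖ ≤ H.L * (‖x - z‖ ^ 2 + ‖x - z'‖ ^ 2) := by
  have h : P.fLin z' x u - P.fLin z x u
      = (P.f₀ x - (P.f₀ z + fderiv ℝ P.f₀ z (x - z)))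
        - (P.f₀ x - (P.f₀ z' + fderiv ℝ P.f₀ z' (x - z'))) := by
    simp only [fLin_eq]; abel
  rw [h, mul_add]
  exact (norm_sub_le _ _).trans (add_le_add (H.taylor_f z x hz hx) (H.taylor_f z' x hz' hx))

theorem norm_hLin_sub_le {z z' x : Vec n} (hz : ‖z‖ ≤ H.ρ) (hz' : ‖z'‖ ≤ H.ρ) (hx : ‖x‖ ≤ H.ρ)
    (u : Vec m) : ‖P.hLin z' x u - P.hLin z x u‖ ≤ H.L * (‖x - z‖ ^ 2 + ‖x - z'‖ ^ 2) := by
  have h : P.hLin z' x u - P.hLin z x u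
      = (P.h₀ x - (P.h₀ z + fderiv ℝ P.h₀ z (x - z)))
        - (P.h₀ x - (P.h₀ z' + fderiv ℝ P.h₀ z' (x - z'))) := by
    simp only [hLin_eq]; abel
  rw [h, mul_add]
  exact (norm_sub_le _ _).trans (add_le_add (H.taylor_h z x hz hx) (H.taylor_h z' x hz' hx))

theorem norm_equilibrium_le {z : Vec n} {q : Vec n × Vec m} (hq : q ∈ P.ZLin z) :
    ‖q.1‖ ≤ H.ρ := by
  linarith [H.norm_eq_le z q hq]

/-- Equilibria with the same input depend on the point of linearization to second order. -/
theorem exists_equilibrium_sub_le : ∃ G : ℝ, 0 ≤ G ∧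
    ∀ z z', ‖z‖ ≤ H.ρ → ‖z'‖ ≤ H.ρ → ∀ q ∈ P.ZLin z, ∀ q' ∈ P.ZLin z', q'.2 = q.2 →
      ‖q'.1 - q.1‖ ≤ G * (‖q.1 - z‖ ^ 2 + ‖q.1 - z'‖ ^ 2) ∧
      ‖P.hLin z' q'.1 q'.2 - P.hLin z q.1 q.2‖ ≤ G * (‖q.1 - z‖ ^ 2 + ‖q.1 - z'‖ ^ 2) := by
  have ha := H.a_pos
  have hL := H.one_le_L
  set g := H.L / H.a
  have hg : 0 ≤ g := by positivity
  refine ⟨g + H.L * g + H.L, by positivity, fun z z' hz hz' q hq q' hq' hu => ?_⟩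
  have hqρ := H.norm_equilibrium_le hq
  set s := ‖q.1 - z‖ ^ 2 + ‖q.1 - z'‖ ^ 2
  have hs : 0 ≤ s := by positivity
  -- Subtracting the two fixed-point equations puts `I - A_{z'}` in front of the difference, and
  -- `nonsing` inverts it.
  have h1 : q'.1 - q.1 - fderiv ℝ P.f₀ z' (q'.1 - q.1)
      = P.fLin z' q.1 q.2 - P.fLin z q.1 q.2 := by
    have := P.fLin_sub_fLin z' q'.1 q.1 q'.2 q.2
    rw [← hq'.2, hu, sub_self, map_zero, add_zero] at this
    rw [← this, ← hq.2]
    abel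
  have h2 : ‖q'.1 - q.1‖ ≤ g * s := by
    have h3 := (H.nonsing z' (q'.1 - q.1)).trans_eq (congrArg _ h1)
    have h4 := h3.trans (H.norm_fLin_sub_le hz hz' hqρ _)
    rw [div_mul_eq_mul_div, le_div_iff₀ ha, mul_comm]
    exact h4
  constructor
  · refine h2.trans ?_
    gcongr
    nlinarith
  · have h3 : P.hLin z' q'.1 q'.2 - P.hLin z q.1 q.2 = fderiv ℝ P.h₀ z' (q'.1 - q.1)
        + (P.hLin z' q.1 q.2 - P.hLin z q.1 q.2) := by
      have := P.hLin_sub_hLin z' q'.1 q.1 q'.2 q.2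
      rw [hu, sub_self, map_zero, add_zero] at this
      rw [← this, hu]
      abel
    calc _ ≤ H.L * ‖q'.1 - q.1‖ + H.L * s := by
          rw [h3]
          exact (norm_add_le _ _).trans
            (add_le_add (H.norm_fderiv_h z' hz' _) (H.norm_hLin_sub_le hz hz' hqρ _))
      _ ≤ H.L * (g * s) + H.L * s := by gcongr
      _ ≤ _ := by nlinarith [mul_nonneg hg hs]

theorem exists_equilibrium (z : Vec n) {u : Vec m} (hu : u ∈ P.Us) :
    ∃ x, (x, u) ∈ P.ZLin z := by
  set A := (fderiv ℝ P.f₀ z).toLinearMap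
  have hinj : Function.Injective (LinearMap.id - A : Vec n →ₗ[ℝ] Vec n) := by
    rw [injective_iff_map_eq_zero]
    intro v hv
    have h1 := H.nonsing z v
    have h2 : v - fderiv ℝ P.f₀ z v = 0 := hv
    rw [h2, norm_zero] at h1
    have h3 : ‖v‖ ≤ 0 := by
      by_contra h
      push Not at h
      nlinarith [mul_pos H.a_pos h]
    simpa using h3
  obtain ⟨x, hx⟩ := LinearMap.injective_iff_surjective.mp hinj
    (P.f₀ z - fderiv ℝ P.f₀ z z + Matrix.toEuclideanLin P.B u)
  refine ⟨x, hu, ?_⟩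
  have h1 : x - fderiv ℝ P.f₀ z x = P.f₀ z - fderiv ℝ P.f₀ z z + Matrix.toEuclideanLin P.B u := hx
  simp only [fLin_eq, map_sub]
  rw [sub_eq_iff_eq_add] at h1
  nth_rewrite 1 [h1]
  abel

theorem isCompact_ZLin (hU : IsCompact P.Us) (z : Vec n) : IsCompact (P.ZLin z) := by
  refine ((isCompact_closedBall (0 : Vec n) (H.ρ - 3)).prod hU).of_isClosed_subset ?_ ?_
  · refine IsClosed.inter (hU.isClosed.preimage continuous_snd)
      (isClosed_eq continuous_fst ?_)
    simp only [fLin]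
    have h1 := LinearMap.continuous_of_finiteDimensional (Matrix.toEuclideanLin (P.A z))
    have h2 := LinearMap.continuous_of_finiteDimensional (Matrix.toEuclideanLin P.B)
    fun_prop
  · intro q hq
    exact ⟨by simpa using H.norm_eq_le z q hq, hq.1⟩

omit H in
theorem continuous_hLin (z : Vec n) : Continuous fun q : Vec n × Vec m => P.hLin z q.1 q.2 := by
  simp only [hLin]
  have h1 := LinearMap.continuous_of_finiteDimensional (Matrix.toEuclideanLin (P.C z))
  have h2 := LinearMap.continuous_of_finiteDimensional (Matrix.toEuclideanLin P.D)
  fun_prop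

theorem offsetCost_eq (z : Vec n) (q : Vec n × Vec m) :
    P.offsetCost z q = ‖H.TS (P.hLin z q.1 q.2 - P.yr)‖ ^ 2 := H.wsq_S _

/-- Existence of an optimal equilibrium, and quadratic growth of the cost around it. -/
theorem exists_optimal_equilibrium (hU : IsCompact P.Us) (hconv : Convex ℝ P.Us) {z : Vec n}
    (hne : (P.ZLin z).Nonempty) :
    ∃ q₀ ∈ P.ZLin z, P.offsetCost z q₀ = P.JeqLin z ∧ ∀ q ∈ P.ZLin z,
      (H.a ^ 2 * ‖q.1 - q₀.1‖) ^ 2 ≤ P.offsetCost z q - P.JeqLin z ∧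
      (H.a ^ 2 * ‖q.2 - q₀.2‖) ^ 2 ≤ P.offsetCost z q - P.JeqLin z := by
  have hcont : Continuous (P.offsetCost z) := by
    have h : P.offsetCost z = fun q => ‖H.TS (P.hLin z q.1 q.2 - P.yr)‖ ^ 2 :=
      funext (H.offsetCost_eq z)
    rw [h]
    have := continuous_hLin (P := P) z
    fun_prop
  obtain ⟨q₀, hq₀, hmin⟩ := (H.isCompact_ZLin hU z).exists_isMinOn hne hcont.continuousOn
  have hJ : P.offsetCost z q₀ = P.JeqLin z := by
    symm
    refine IsLeast.csInf_eq ⟨⟨_, ⟨q₀, hq₀, rfl⟩, rfl⟩, ?_⟩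
    rintro _ ⟨_, ⟨q, hq, rfl⟩, rfl⟩
    exact hmin hq
  refine ⟨q₀, hq₀, hJ, fun q hq => ?_⟩
  set Y := H.TS (P.hLin z q₀.1 q₀.2 - P.yr)
  set Δ := H.TS (P.hLin z q.1 q.2 - P.hLin z q₀.1 q₀.2)
  -- The variational inequality at the minimizer; it gives the cross term a favourable sign, so the
  -- cost grows by at least `‖Δ‖²`.
  have hinner : 0 ≤ inner ℝ Y Δ := by
    refine nonneg_of_forall_quadratic_nonneg (sq_nonneg ‖Δ‖) fun t ht0 ht1 => ?_
    have h1 : P.offsetCost z q₀ ≤ P.offsetCost z ((1 - t) • q₀ + t • q) :=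
      hmin (convexCombination_mem_ZLin hconv hq₀ hq ht0.le ht1)
    have h2 : H.TS (P.hLin z ((1 - t) • q₀ + t • q).1 ((1 - t) • q₀ + t • q).2 - P.yr)
        = Y + t • Δ := by
      rw [hLin_convexCombination, ← map_smul, ← map_add]
      congr 1
      module
    rw [H.offsetCost_eq, H.offsetCost_eq, h2, norm_add_sq_real, inner_smul_right, norm_smul,
      mul_pow, Real.norm_eq_abs, sq_abs] at h1
    change ‖Y‖ ^ 2 ≤ _ at h1
    linarith
  have hgrow : ‖Δ‖ ^ 2 ≤ P.offsetCost z q - P.JeqLin z := by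
    have h2 : H.TS (P.hLin z q.1 q.2 - P.yr) = Y + Δ := by
      rw [← map_add]; congr 1; abel
    rw [← hJ, H.offsetCost_eq, H.offsetCost_eq, h2, norm_add_sq_real]
    change _ ≤ _ - ‖Y‖ ^ 2
    linarith
  have hdiff : P.hLin z q.1 q.2 - P.hLin z q₀.1 q₀.2 = fderiv ℝ P.h₀ z (q.1 - q₀.1)
      + Matrix.toEuclideanLin P.D (q.2 - q₀.2) := P.hLin_sub_hLin _ _ _ _ _
  -- The difference of two equilibria solves the homogeneous equation, so `unique` applies; it gives
  -- one factor `a`, and `le_TS` the other.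
  have heq : q.1 - q₀.1 = fderiv ℝ P.f₀ z (q.1 - q₀.1)
      + Matrix.toEuclideanLin P.B (q.2 - q₀.2) := by
    rw [← P.fLin_sub_fLin, ← hq.2, ← hq₀.2]
  obtain ⟨h1, h2⟩ := H.unique z _ _ heq
  rw [← hdiff] at h1 h2
  have hT : H.a * ‖P.hLin z q.1 q.2 - P.hLin z q₀.1 q₀.2‖ ≤ ‖Δ‖ := H.le_TS _
  have ha := H.a_pos
  constructor
  · refine le_trans (pow_le_pow_left₀ (by positivity) (le_trans ?_ hT) 2) hgrow
    rw [sq, mul_assoc]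
    gcongr
  · refine le_trans (pow_le_pow_left₀ (by positivity) (le_trans ?_ hT) 2) hgrow
    rw [sq, mul_assoc]
    gcongr

theorem offsetCost_convexCombination_le (z : Vec n) (q q' : Vec n × Vec m) {t : ℝ} (h0 : 0 ≤ t)
    (h1 : t ≤ 1) : P.offsetCost z ((1 - t) • q + t • q')
      ≤ (1 - t) * P.offsetCost z q + t * P.offsetCost z q' := by
  simp only [H.offsetCost_eq, hLin_convexCombination]
  have : H.TS ((1 - t) • P.hLin z q.1 q.2 + t • P.hLin z q'.1 q'.2 - P.yr)
      = (1 - t) • H.TS (P.hLin z q.1 q.2 - P.yr) + t • H.TS (P.hLin z q'.1 q'.2 - P.yr) := by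
    rw [← map_smul, ← map_smul, ← map_add]
    congr 1
    module
  rw [this]
  exact norm_convexCombination_sq_le _ _ h0 h1

end Estimates

end Setup

/-! ### Tracking cost, prediction errors and shifted candidates. -/

theorem norm_add_sq_le_weighted {E : Type*} [NormedAddCommGroup E] (x y : E) {ε : ℝ} (hε : 0 < ε) :
    ‖x + y‖ ^ 2 ≤ (1 + ε) * ‖x‖ ^ 2 + (1 + ε⁻¹) * ‖y‖ ^ 2 := by
  refine (pow_le_pow_left₀ (norm_nonneg _) (norm_add_le x y) 2).trans ?_
  have h : 0 ≤ ε⁻¹ * (ε * ‖x‖ - ‖y‖) ^ 2 := by positivity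
  have h2 : ε⁻¹ * (ε * ‖x‖ - ‖y‖) ^ 2 = ε * ‖x‖ ^ 2 - 2 * ‖x‖ * ‖y‖ + ε⁻¹ * ‖y‖ ^ 2 := by
    field_simp
    ring
  rw [h2] at h
  linarith

namespace Setup

variable {n m p : ℕ} {P : Setup n m p}

/-- The stage cost at time `k`. -/
noncomputable def stageCost (P : Setup n m p) (v : Plan n m p) (k : ℕ) : ℝ :=
  wsq P.Q (v.x k - v.xs) + wsq P.R (v.u k - v.us)

theorem trackCost_eq (v : Plan n m p) :
    P.trackCost v = ∑ k ∈ Finset.range P.N, P.stageCost v k := rfl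

theorem Feasible.cost_eq {z : Vec n} {v : Plan n m p} (hv : P.Feasible z v) :
    P.cost v = P.trackCost v + P.offsetCost z (v.xs, v.us) := by
  simp only [cost, trackCost, offsetCost, hv.output]

namespace Estimates

variable (H : P.Estimates)

include H

theorem stageCost_nonneg (v : Plan n m p) (k : ℕ) : 0 ≤ P.stageCost v k := by
  simp only [stageCost, H.wsq_Q, H.wsq_R]
  positivity

theorem trackCost_nonneg (v : Plan n m p) : 0 ≤ P.trackCost v :=
  Finset.sum_nonneg fun k _ => H.stageCost_nonneg v k

theorem offsetCost_nonneg (z : Vec n) (q : Vec n × Vec m) : 0 ≤ P.offsetCost z q := by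
  rw [H.offsetCost_eq]
  positivity

theorem sq_norm_le_stageCost (v : Plan n m p) (k : ℕ) :
    (H.a * ‖v.x k - v.xs‖) ^ 2 ≤ P.stageCost v k := by
  have ha := H.a_pos
  simp only [stageCost, H.wsq_Q, H.wsq_R]
  have := pow_le_pow_left₀ (by positivity) (H.le_TQ (v.x k - v.xs)) 2
  linarith [sq_nonneg ‖H.TR (v.u k - v.us)‖]

theorem norm_state_sub_le {z : Vec n} {v : Plan n m p} (hv : P.Feasible z v) {k : ℕ}
    (hk : k ≤ P.N) : ‖v.x k - v.xs‖ ≤ H.a⁻¹ * √(P.trackCost v) := by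
  have ha := H.a_pos
  rcases hk.lt_or_eq with hk | rfl
  · rw [le_inv_mul_iff₀ ha]
    refine Real.le_sqrt_of_sq_le ((H.sq_norm_le_stageCost v k).trans ?_)
    exact Finset.single_le_sum (f := P.stageCost v) (fun k _ => H.stageCost_nonneg v k)
      (Finset.mem_range.mpr hk)
  · rw [hv.terminal, sub_self, norm_zero]
    positivity

/-- The first `n` stage costs of an optimal solution are a fixed fraction of its tracking cost. -/
theorem exists_sum_tail_stageCost_le (hN : n ≤ P.N) : ∃ c r : ℝ, 0 < c ∧ c ≤ 1 ∧ 0 < r ∧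
    ∀ z v, P.Optimal z v → ‖z‖ ≤ H.ρ → ‖z - v.xs‖ ≤ r →
      ∑ k ∈ Finset.Ico n P.N, P.stageCost v k ≤ (1 - c) * P.trackCost v := by
  obtain ⟨G, r, hG, hr, hpre⟩ := H.exists_feasible_of_prefix
  have ha := H.a_pos
  have ha1 := H.a_le_one
  refine ⟨H.a ^ 2 / (G + 1), r, by positivity, ?_, hr, fun z v hv hz hzr => ?_⟩
  · rw [div_le_one (by positivity)]
    nlinarith
  -- Empty prefix: deadbeat control from the start to the same equilibrium. The offset costs agree,
  -- so optimality compares tracking costs alone.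
  obtain ⟨w, hw, hwx, hwu, hcost⟩ := hpre z hz _ hv.1.equilibrium 0 (by omega) (fun _ => z)
    v.u rfl (by simp) (by simp) hzr
  have h1 := hv.2 w hw
  rw [hv.1.cost_eq, hw.cost_eq, hwx, hwu] at h1
  have h2 : P.trackCost v ≤ G * ‖z - v.xs‖ ^ 2 := by
    simp only [Finset.range_zero, Finset.sum_empty, zero_add] at hcost
    linarith
  have h3 : H.a ^ 2 * ‖z - v.xs‖ ^ 2 ≤ ∑ k ∈ Finset.range n, P.stageCost v k := by
    rcases Nat.eq_zero_or_pos n with rfl | hn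
    · simp [Subsingleton.elim z v.xs]
    · have h4 := H.sq_norm_le_stageCost v 0
      rw [hv.1.initial, mul_pow] at h4
      exact h4.trans (Finset.single_le_sum (f := P.stageCost v)
        (fun k _ => H.stageCost_nonneg v k) (Finset.mem_range.mpr hn))
  have h5 := Finset.sum_range_add_sum_Ico (P.stageCost v) hN
  rw [← trackCost_eq] at h5
  have h6 : H.a ^ 2 / (G + 1) * P.trackCost v ≤ H.a ^ 2 * ‖z - v.xs‖ ^ 2 := by
    rw [div_mul_eq_mul_div, div_le_iff₀ (by positivity), mul_assoc]
    gcongr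
    nlinarith [sq_nonneg ‖z - v.xs‖]
  linarith

theorem norm_state_le {z : Vec n} {v : Plan n m p} (hv : P.Feasible z v)
    (hs : √(P.trackCost v) ≤ H.a) {k : ℕ} (hk : k ≤ P.N) : ‖v.x k‖ ≤ H.ρ - 2 := by
  have ha := H.a_pos
  have h1 := H.norm_state_sub_le hv hk
  have h2 : H.a⁻¹ * √(P.trackCost v) ≤ 1 := by
    rw [inv_mul_le_iff₀ ha]; linarith
  have h3 := H.norm_eq_le z _ hv.equilibrium
  have h4 : ‖v.x k‖ ≤ ‖v.x k - v.xs‖ + ‖v.xs‖ := by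
    simpa using norm_add_le (v.x k - v.xs) v.xs
  dsimp only at h3
  linarith

/-- The prediction error of the linearized model is of second order. -/
theorem exists_rollout_sub_le {k : ℕ} (hk : k ≤ P.N) : ∃ G ε : ℝ, 0 ≤ G ∧ 0 < ε ∧ ε ≤ H.a ∧
    ∀ z v, P.Feasible z v → √(P.trackCost v) ≤ ε →
      ‖P.rollout z v.u k - v.x k‖ ≤ G * P.trackCost v := by
  have ha := H.a_pos
  have hL := H.one_le_L
  induction k with
  | zero => exact ⟨0, H.a, le_rfl, ha, le_rfl, fun z v hv _ => by simp [rollout, hv.initial]⟩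
  | succ k ih =>
    obtain ⟨G, ε, hG, hε, hεa, h⟩ := ih (by omega)
    refine ⟨H.L * (G + 2 * H.a⁻¹) ^ 2 + H.L * G, min ε (1 / (G + 1)), by positivity,
      by positivity, (min_le_left _ _).trans hεa, fun z v hv hs => ?_⟩
    set s := √(P.trackCost v) with hsdef
    have hs0 : 0 ≤ s := Real.sqrt_nonneg _
    have hss : P.trackCost v = s ^ 2 := (Real.sq_sqrt (H.trackCost_nonneg v)).symm
    have hsε : s ≤ ε := hs.trans (min_le_left _ _)
    have hsG : s * (G + 1) ≤ 1 := by
      rw [← le_div_iff₀ (by positivity)]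
      exact hs.trans (min_le_right _ _)
    have hsa : s ≤ H.a := hsε.trans hεa
    have hs1 : s ≤ 1 := hsa.trans H.a_le_one
    have hek := h z v hv hsε
    rw [hss] at hek ⊢
    set X := P.rollout z v.u k
    have hxk := H.norm_state_le hv hsa (show k ≤ P.N by omega)
    have hz : ‖z‖ ≤ H.ρ := by
      have := H.norm_state_le hv hsa (Nat.zero_le _)
      rw [hv.initial] at this
      linarith
    have h1 : ‖X - v.x k‖ ≤ G * s := hek.trans (by gcongr; nlinarith)
    have hX : ‖X‖ ≤ H.ρ := by
      have h2 : ‖X‖ ≤ ‖X - v.x k‖ + ‖v.x k‖ := by simpa using norm_add_le (X - v.x k) (v.x k)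
      nlinarith
    have hXz : ‖X - z‖ ≤ (G + 2 * H.a⁻¹) * s := by
      have h2 := H.norm_state_sub_le hv (show k ≤ P.N by omega)
      have h3 := H.norm_state_sub_le hv (Nat.zero_le P.N)
      rw [hv.initial] at h3
      have h4 : X - z = (X - v.x k) + (v.x k - v.xs) - (z - v.xs) := by abel
      calc ‖X - z‖ ≤ ‖X - v.x k‖ + ‖v.x k - v.xs‖ + ‖z - v.xs‖ := by
            rw [h4]
            exact (norm_sub_le _ _).trans (by gcongr; exact norm_add_le _ _)
        _ ≤ G * s + H.a⁻¹ * s + H.a⁻¹ * s := by gcongr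
        _ = _ := by ring
    -- The new error is a Taylor remainder at the true state plus the old error propagated by the
    -- linearization.
    have hstep : P.rollout z v.u (k + 1) - v.x (k + 1)
        = (P.f₀ X - (P.f₀ z + fderiv ℝ P.f₀ z (X - z))) + fderiv ℝ P.f₀ z (X - v.x k) := by
      rw [hv.dynamics k (by omega), fLin_eq]
      simp only [rollout, f, map_sub, X]
      abel
    calc _ ≤ H.L * ‖X - z‖ ^ 2 + H.L * ‖X - v.x k‖ := by
          rw [hstep]
          exact (norm_add_le _ _).trans
            (add_le_add (H.taylor_f z X hz hX) (H.norm_fderiv_f z hz _))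
      _ ≤ H.L * ((G + 2 * H.a⁻¹) * s) ^ 2 + H.L * (G * s ^ 2) := by gcongr
      _ = _ := by ring

/-- Trajectories under the same inputs of the linearizations at two nearby points. -/
theorem norm_trajectory_sub_le {z z' : Vec n} (hz : ‖z‖ ≤ H.ρ) (hz' : ‖z'‖ ≤ H.ρ) {K : ℕ}
    {x y : ℕ → Vec n} {u : ℕ → Vec m} (hx : ∀ k < K, x (k + 1) = P.fLin z (x k) (u k))
    (hy : ∀ k < K, y (k + 1) = P.fLin z' (y k) (u k)) (hρ : ∀ k < K, ‖x k‖ ≤ H.ρ) {d : ℝ}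
    (hd : ∀ k < K, ‖x k - z‖ ^ 2 + ‖x k - z'‖ ^ 2 ≤ d) (h0 : ‖y 0 - x 0‖ ≤ d) {k : ℕ}
    (hk : k ≤ K) : ‖y k - x k‖ ≤ (2 * H.L) ^ k * d := by
  have hL := H.one_le_L
  have hd0 : 0 ≤ d := (norm_nonneg _).trans h0
  induction k with
  | zero => simpa using h0
  | succ k ih =>
    have hk' : k < K := by omega
    have h1 : y (k + 1) - x (k + 1) = fderiv ℝ P.f₀ z' (y k - x k)
        + (P.fLin z' (x k) (u k) - P.fLin z (x k) (u k)) := by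
      rw [hx k hk', hy k hk']
      have := P.fLin_sub_fLin z' (y k) (x k) (u k) (u k)
      rw [sub_self, map_zero, add_zero] at this
      rw [← this]
      abel
    have h2 : 1 ≤ (2 * H.L) ^ k := one_le_pow₀ (by linarith)
    calc _ ≤ H.L * ‖y k - x k‖ + H.L * (‖x k - z‖ ^ 2 + ‖x k - z'‖ ^ 2) := by
          rw [h1]
          exact (norm_add_le _ _).trans (add_le_add (H.norm_fderiv_f z' hz' _)
            (H.norm_fLin_sub_le hz hz' (hρ k hk') _))
      _ ≤ H.L * ((2 * H.L) ^ k * d) + H.L * ((2 * H.L) ^ k * d) := by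
          gcongr
          · exact ih hk'.le
          · exact (hd k hk').trans (by nlinarith)
      _ = _ := by ring

/-- The shifted inputs, followed by a deadbeat controller, as a candidate solution. -/
theorem exists_shifted_candidate (hN : n ≤ P.N) : ∃ G r : ℝ, 0 ≤ G ∧ 0 < r ∧
    ∀ z v, P.Feasible z v → ∀ z', ‖z'‖ ≤ H.ρ → ∀ q ∈ P.ZLin z', ∀ y : ℕ → Vec n, y 0 = z' →
      (∀ k < P.N - n, y (k + 1) = P.fLin z' (y k) (v.u (n + k))) → ∀ d, d ≤ r →
      (∀ k ≤ P.N - n, ‖(y k - q.1) - (v.x (n + k) - v.xs)‖ ≤ d) → ‖q.2 - v.us‖ ≤ d →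
      ∀ ε, 0 < ε → ∃ w, P.Feasible z' w ∧ w.xs = q.1 ∧ w.us = q.2 ∧
        P.trackCost w ≤ (1 + ε) * ∑ k ∈ Finset.Ico n P.N, P.stageCost v k
          + G * (1 + ε⁻¹) * d ^ 2 := by
  obtain ⟨G, r, hG, hr, hpre⟩ := H.exists_feasible_of_prefix
  have hL := H.one_le_L
  refine ⟨P.N * (2 * H.L ^ 2) + G, r, by positivity, hr, ?_⟩
  intro z v hv z' hz' q hq y hy0 hy d hdr hd hdu ε hε
  have hd0 : 0 ≤ d := (norm_nonneg _).trans hdu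
  -- At the last shifted index the old plan sits at its equilibrium, so the deviation bound is a
  -- bound on the distance to `q.1`.
  have hend : ‖y (P.N - n) - q.1‖ ≤ d := by
    have := hd (P.N - n) le_rfl
    rwa [Nat.add_sub_cancel' hN, hv.terminal, sub_self, sub_zero] at this
  obtain ⟨w, hw, hwx, hwu, hcost⟩ := hpre z' hz' q hq (P.N - n) (by omega) y
    (fun k => v.u (n + k)) hy0 hy (fun k hk => hv.input _ (by omega)) (hend.trans hdr)
  refine ⟨w, hw, hwx, hwu, hcost.trans ?_⟩
  have hε' : 0 < ε⁻¹ := inv_pos.mpr hε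
  have hstage : ∀ k < P.N - n, wsq P.Q (y k - q.1) + wsq P.R (v.u (n + k) - q.2)
      ≤ (1 + ε) * P.stageCost v (n + k) + (1 + ε⁻¹) * (2 * H.L ^ 2 * d ^ 2) := by
    intro k hk
    have h1 : y k - q.1 = (v.x (n + k) - v.xs) + ((y k - q.1) - (v.x (n + k) - v.xs)) := by abel
    have h2 : v.u (n + k) - q.2 = (v.u (n + k) - v.us) + (v.us - q.2) := by abel
    -- The weighted inequality keeps the old stage cost with a factor near one, which preserves the
    -- decrease gained from the dropped stages.
    have h3 := norm_add_sq_le_weighted (H.TQ (v.x (n + k) - v.xs))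
      (H.TQ ((y k - q.1) - (v.x (n + k) - v.xs))) hε
    have h4 := norm_add_sq_le_weighted (H.TR (v.u (n + k) - v.us)) (H.TR (v.us - q.2)) hε
    rw [← map_add, ← h1] at h3
    rw [← map_add, ← h2] at h4
    have h5 : ‖H.TQ ((y k - q.1) - (v.x (n + k) - v.xs))‖ ^ 2 ≤ (H.L * d) ^ 2 :=
      pow_le_pow_left₀ (norm_nonneg _) ((H.TQ_le _).trans (by gcongr; exact hd k hk.le)) 2
    have h6 : ‖H.TR (v.us - q.2)‖ ^ 2 ≤ (H.L * d) ^ 2 :=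
      pow_le_pow_left₀ (norm_nonneg _)
        ((H.TR_le _).trans (by gcongr; rwa [norm_sub_rev])) 2
    simp only [stageCost, H.wsq_Q, H.wsq_R]
    calc _ ≤ _ := add_le_add h3 h4
      _ ≤ ((1 + ε) * ‖H.TQ (v.x (n + k) - v.xs)‖ ^ 2 + (1 + ε⁻¹) * (H.L * d) ^ 2)
          + ((1 + ε) * ‖H.TR (v.u (n + k) - v.us)‖ ^ 2 + (1 + ε⁻¹) * (H.L * d) ^ 2) := by
          gcongr
      _ = _ := by ring
  have hsum : ∑ k ∈ Finset.range (P.N - n), (wsq P.Q (y k - q.1) + wsq P.R (v.u (n + k) - q.2))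
      ≤ (1 + ε) * ∑ k ∈ Finset.Ico n P.N, P.stageCost v k
        + P.N * ((1 + ε⁻¹) * (2 * H.L ^ 2 * d ^ 2)) := by
    rw [Finset.sum_Ico_eq_sum_range, Finset.mul_sum]
    calc _ ≤ ∑ k ∈ Finset.range (P.N - n), ((1 + ε) * P.stageCost v (n + k)
            + (1 + ε⁻¹) * (2 * H.L ^ 2 * d ^ 2)) :=
          Finset.sum_le_sum fun k hk => hstage k (Finset.mem_range.mp hk)
      _ = ∑ k ∈ Finset.range (P.N - n), (1 + ε) * P.stageCost v (n + k)
            + (P.N - n : ℕ) * ((1 + ε⁻¹) * (2 * H.L ^ 2 * d ^ 2)) := by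
          rw [Finset.sum_add_distrib]; simp
      _ ≤ _ := by
          gcongr
          omega
  have hfin : G * ‖y (P.N - n) - q.1‖ ^ 2 ≤ G * (1 + ε⁻¹) * d ^ 2 := by
    have h1 : ‖y (P.N - n) - q.1‖ ^ 2 ≤ d ^ 2 := pow_le_pow_left₀ (norm_nonneg _) hend 2
    have h2 : 0 ≤ G * ε⁻¹ * d ^ 2 := by positivity
    nlinarith [mul_le_mul_of_nonneg_left h1 hG]
  calc _ ≤ _ := add_le_add hsum hfin
    _ = _ := by ring

/-! ### Equilibrium costs across linearizations, and the shifted trajectory. -/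

/-- Expanding the square, the linear term carries the factor `b`, the distance to the setpoint. This
is where small equilibrium costs pay off. -/
theorem offsetCost_sub_le {z z' : Vec n} {q q' : Vec n × Vec m} {b d : ℝ}
    (hb : ‖H.TS (P.hLin z q.1 q.2 - P.yr)‖ ≤ b)
    (hd : ‖P.hLin z' q'.1 q'.2 - P.hLin z q.1 q.2‖ ≤ d) :
    P.offsetCost z' q' ≤ P.offsetCost z q + 2 * b * (H.L * d) + (H.L * d) ^ 2 := by
  have hL := H.one_le_L
  set Y := H.TS (P.hLin z q.1 q.2 - P.yr)
  set Δ := H.TS (P.hLin z' q'.1 q'.2 - P.hLin z q.1 q.2)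
  have h1 : H.TS (P.hLin z' q'.1 q'.2 - P.yr) = Y + Δ := by
    rw [← map_add]; congr 1; abel
  have h2 : ‖Δ‖ ≤ H.L * d := (H.TS_le _).trans (by gcongr)
  have h3 : ‖Y + Δ‖ ≤ ‖Y‖ + ‖Δ‖ := norm_add_le _ _
  rw [H.offsetCost_eq, H.offsetCost_eq, h1]
  change _ ≤ ‖Y‖ ^ 2 + _ + _
  have h4 : ‖Y‖ * ‖Δ‖ ≤ b * (H.L * d) :=
    mul_le_mul hb h2 (norm_nonneg _) ((norm_nonneg _).trans hb)
  have h5 : ‖Δ‖ ^ 2 ≤ (H.L * d) ^ 2 := pow_le_pow_left₀ (norm_nonneg _) h2 2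
  have h6 := pow_le_pow_left₀ (norm_nonneg _) h3 2
  nlinarith

set_option maxHeartbeats 1000000 in
/-- Changing the point of linearization affects the suboptimality of an equilibrium by an
arbitrarily small fraction of `V`, if the optimal equilibrium costs are small. -/
theorem exists_offsetCost_sub_JeqLin_le (hU : IsCompact P.Us) (hconv : Convex ℝ P.Us) {M η : ℝ}
    (hM : 0 ≤ M) (hη : 0 < η) : ∃ θ : ℝ, 0 < θ ∧ ∀ z z', ‖z‖ ≤ H.ρ → ‖z'‖ ≤ H.ρ →
      ∀ q ∈ P.ZLin z, ∀ q' ∈ P.ZLin z', ∀ V, 0 ≤ V → V ≤ θ ^ 2 → P.JeqLin z ≤ θ ^ 2 →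
        P.JeqLin z' ≤ θ ^ 2 → P.offsetCost z q - P.JeqLin z ≤ V →
        ‖P.hLin z' q'.1 q'.2 - P.hLin z q.1 q.2‖ ≤ M * V → ‖q'.1 - z‖ ^ 2 ≤ M * V →
        ‖q'.1 - z'‖ ^ 2 ≤ M * V →
        P.offsetCost z' q' - P.JeqLin z' ≤ P.offsetCost z q - P.JeqLin z + η * V := by
  obtain ⟨G, hG, hpert⟩ := H.exists_equilibrium_sub_le
  have ha := H.a_pos
  have hL := H.one_le_L
  set L := H.L
  set α := H.a ^ 2 with hα
  have hα0 : 0 < α := by positivity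
  -- `κ₁` bounds the cost change from `q` to `q'`, `κ₂` the distance from `q'` to the optimum at
  -- `z'`, `κ₃` the output change when that optimum is moved to `z`, `κ₄` the resulting change of
  -- optimal cost; `κ₅` gives a crude bound on the new suboptimality and `κ₆` the total.
  obtain ⟨κ₁, hκ₁⟩ : ∃ κ, κ = 4 * L * M + (L * M) ^ 2 := ⟨_, rfl⟩
  obtain ⟨κ₂, hκ₂⟩ : ∃ κ, κ = (2 + L * M) / α := ⟨_, rfl⟩
  obtain ⟨κ₃, hκ₃⟩ : ∃ κ, κ = 4 * G * (M + κ₂ ^ 2) := ⟨_, rfl⟩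
  obtain ⟨κ₄, hκ₄⟩ : ∃ κ, κ = (2 * L + L ^ 2 * κ₃) * (4 * G) := ⟨_, rfl⟩
  obtain ⟨κ₅, hκ₅⟩ : ∃ κ, κ = 2 * (1 + κ₁ + κ₄ * M) := ⟨_, rfl⟩
  obtain ⟨κ₆, hκ₆⟩ : ∃ κ, κ = κ₁ + κ₄ * M + κ₄ * (κ₅ / α ^ 2) := ⟨_, rfl⟩
  have hκ₁0 : 0 ≤ κ₁ := by rw [hκ₁]; positivity
  have hκ₂0 : 0 ≤ κ₂ := by rw [hκ₂]; positivity
  have hκ₃0 : 0 ≤ κ₃ := by rw [hκ₃]; positivity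
  have hκ₄0 : 0 ≤ κ₄ := by rw [hκ₄]; positivity
  have hκ₅0 : 0 ≤ κ₅ := by rw [hκ₅]; positivity
  have hκ₆0 : 0 ≤ κ₆ := by rw [hκ₆]; positivity
  obtain ⟨θ, hθ, hθ1, hθα, hθη⟩ : ∃ θ : ℝ, 0 < θ ∧ θ ≤ 1 ∧ θ * (2 * (κ₄ + 1)) ≤ α ^ 2 ∧
      θ * (κ₆ + 1) ≤ η := by
    refine ⟨min 1 (min (α ^ 2 / (2 * (κ₄ + 1))) (η / (κ₆ + 1))), by positivity,
      min_le_left _ _, ?_, ?_⟩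
    · rw [← le_div_iff₀ (by positivity)]
      exact (min_le_right _ _).trans (min_le_left _ _)
    · rw [← le_div_iff₀ (by positivity)]
      exact (min_le_right _ _).trans (min_le_right _ _)
  refine ⟨θ, hθ, ?_⟩
  intro z z' hz hz' q hq q' hq' V hV hVθ hJ hJ' hF1 hh hqz hqz'
  have hθθ : θ ^ 2 ≤ θ := by
    rw [sq]; exact mul_le_of_le_one_left hθ.le hθ1
  have hVθ1 : V ≤ θ := hVθ.trans hθθ
  obtain ⟨q₀, hq₀, hq₀J, hgrow⟩ := H.exists_optimal_equilibrium hU hconv ⟨q', hq'⟩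
  obtain ⟨q₁, hq₁, hq₁J, hgrow₁⟩ := H.exists_optimal_equilibrium hU hconv ⟨q, hq⟩
  -- The optimal equilibrium at `z'` is carried back to `z` with the same input; its cost bounds
  -- `P.JeqLin z` from above.
  obtain ⟨x₂, hx₂⟩ := H.exists_equilibrium z hq₀.1
  have hJx₂ : P.JeqLin z ≤ P.offsetCost z (x₂, q₀.2) :=
    sub_nonneg.mp ((sq_nonneg _).trans (hgrow₁ _ hx₂).1)
  have hY : ‖H.TS (P.hLin z q.1 q.2 - P.yr)‖ ≤ 2 * θ := by
    refine le_of_sq_le_sq ?_ (by positivity)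
    rw [← H.offsetCost_eq]
    linarith [sq_nonneg θ]
  have h21 := H.offsetCost_sub_le hY hh
  have h21' : P.offsetCost z' q' ≤ P.offsetCost z q + κ₁ * θ * V := by
    refine h21.trans ?_
    have : (L * (M * V)) ^ 2 ≤ (L * M) ^ 2 * θ * V := by
      have : (L * (M * V)) ^ 2 = (L * M) ^ 2 * V * V := by ring
      rw [this]
      gcongr
    rw [hκ₁]
    linarith
  have hY' : ‖H.TS (P.hLin z' q'.1 q'.2 - P.yr)‖ ≤ (2 + L * M) * θ := by
    have h1 : H.TS (P.hLin z' q'.1 q'.2 - P.yr) = H.TS (P.hLin z q.1 q.2 - P.yr)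
        + H.TS (P.hLin z' q'.1 q'.2 - P.hLin z q.1 q.2) := by
      rw [← map_add]; congr 1; abel
    rw [h1]
    calc _ ≤ 2 * θ + L * (M * V) :=
          (norm_add_le _ _).trans (add_le_add hY ((H.TS_le _).trans (by gcongr)))
      _ ≤ 2 * θ + L * (M * θ) := by gcongr
      _ = _ := by ring
  set dx := ‖q'.1 - q₀.1‖ with hdx
  have hdx0 : 0 ≤ dx := norm_nonneg _
  have hJ'0 : 0 ≤ P.JeqLin z' := hq₀J ▸ H.offsetCost_nonneg z' q₀
  have hgq := (hgrow q' hq').1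
  have hdxθ : dx ≤ κ₂ * θ := by
    have h1 : α * dx ≤ (2 + L * M) * θ := by
      refine le_of_sq_le_sq (hgq.trans ?_) (by positivity)
      have := pow_le_pow_left₀ (norm_nonneg _) hY' 2
      rw [← H.offsetCost_eq] at this
      linarith
    rw [hκ₂, div_mul_eq_mul_div, le_div_iff₀ hα0]
    linarith
  have hsq : ∀ w : Vec n, ‖q'.1 - w‖ ^ 2 ≤ M * V → ‖q₀.1 - w‖ ^ 2 ≤ 2 * (M * V) + 2 * dx ^ 2 := by
    intro w hw
    have h1 : ‖q₀.1 - w‖ ≤ ‖q'.1 - w‖ + dx := by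
      have h2 : q₀.1 - w = (q'.1 - w) - (q'.1 - q₀.1) := by abel
      rw [h2]
      exact norm_sub_le _ _
    have h3 := pow_le_pow_left₀ (norm_nonneg _) h1 2
    linarith [sq_nonneg (‖q'.1 - w‖ - dx)]
  have hδ : ‖P.hLin z x₂ q₀.2 - P.hLin z' q₀.1 q₀.2‖ ≤ 4 * G * (M * V + dx ^ 2) := by
    refine (hpert z' z hz' hz q₀ hq₀ _ hx₂ rfl).2.trans ?_
    exact (mul_le_mul_of_nonneg_left (add_le_add (hsq z' hqz') (hsq z hqz)) hG).trans_eq (by ring)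
  have hδθ : 4 * G * (M * V + dx ^ 2) ≤ κ₃ * θ := by
    have h1 : dx ^ 2 ≤ κ₂ ^ 2 * θ := by
      calc dx ^ 2 ≤ (κ₂ * θ) ^ 2 := pow_le_pow_left₀ hdx0 hdxθ 2
        _ = κ₂ ^ 2 * θ ^ 2 := by ring
        _ ≤ _ := by gcongr
    calc _ ≤ 4 * G * (M * θ + κ₂ ^ 2 * θ) := by gcongr
      _ = _ := by rw [hκ₃]; ring
  have hY₀ : ‖H.TS (P.hLin z' q₀.1 q₀.2 - P.yr)‖ ≤ θ := by
    refine le_of_sq_le_sq ?_ hθ.le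
    rw [← H.offsetCost_eq, hq₀J]
    exact hJ'
  have h43 : P.JeqLin z ≤ P.JeqLin z' + κ₄ * θ * (M * V + dx ^ 2) := by
    have h1 := H.offsetCost_sub_le (q' := (x₂, q₀.2)) hY₀ hδ
    rw [hq₀J] at h1
    have h2 : (L * (4 * G * (M * V + dx ^ 2))) ^ 2
        ≤ L ^ 2 * (κ₃ * θ) * (4 * G * (M * V + dx ^ 2)) := by
      have : (L * (4 * G * (M * V + dx ^ 2))) ^ 2
          = L ^ 2 * (4 * G * (M * V + dx ^ 2)) * (4 * G * (M * V + dx ^ 2)) := by ring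
      rw [this]
      gcongr
    have h3 : κ₄ * θ * (M * V + dx ^ 2) = 2 * θ * (L * (4 * G * (M * V + dx ^ 2)))
        + L ^ 2 * (κ₃ * θ) * (4 * G * (M * V + dx ^ 2)) := by rw [hκ₄]; ring
    linarith
  set F := P.offsetCost z' q' - P.JeqLin z'
  set F₁ := P.offsetCost z q - P.JeqLin z
  have hF : F ≤ F₁ + κ₁ * θ * V + κ₄ * θ * M * V + κ₄ * θ * dx ^ 2 := by
    simp only [F, F₁]
    linarith
  have hdxF : α ^ 2 * dx ^ 2 ≤ F := by
    rw [← mul_pow]; exact hgq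
  -- The bound on `F` contains `dx ^ 2`, which quadratic growth bounds by `F` itself; `θ` is small
  -- enough to absorb this term into half of `F`.
  have hF2 : F ≤ κ₅ * V := by
    have h1 : κ₄ * θ * dx ^ 2 ≤ F / 2 := by
      have : θ * κ₄ ≤ α ^ 2 / 2 := by linarith
      linarith [mul_le_mul_of_nonneg_right this (sq_nonneg dx)]
    have h2 : κ₁ * θ * V ≤ κ₁ * V := by
      have := mul_le_mul_of_nonneg_left hθ1 (mul_nonneg hκ₁0 hV)
      linarith
    have h3 : κ₄ * θ * M * V ≤ κ₄ * M * V := by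
      have := mul_le_mul_of_nonneg_left hθ1 (mul_nonneg (mul_nonneg hκ₄0 hM) hV)
      linarith
    rw [hκ₅]
    linarith
  have hdxV : dx ^ 2 ≤ κ₅ / α ^ 2 * V := by
    rw [div_mul_eq_mul_div, le_div_iff₀ (by positivity)]
    linarith
  calc F ≤ F₁ + κ₁ * θ * V + κ₄ * θ * M * V + κ₄ * θ * (κ₅ / α ^ 2 * V) := by
        refine hF.trans ?_
        gcongr
    _ = F₁ + θ * κ₆ * V := by rw [hκ₆]; ring
    _ ≤ F₁ + η * V := by
        gcongr
        linarith

set_option maxHeartbeats 1000000 in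
/-- The equilibrium at the successor state that belongs to an input between the artificial
equilibrium input and the optimal one, and the trajectory under the shifted inputs. -/
theorem exists_shifted_trajectory (hN : n ≤ P.N) (hconv : Convex ℝ P.Us) :
    ∃ M ε : ℝ, 0 ≤ M ∧ 0 < ε ∧ ∀ z v, P.Feasible z v → ∀ q₀ ∈ P.ZLin z, ∀ s e, 0 ≤ e → e ≤ s →
      s ≤ ε → √(P.trackCost v) ≤ s → H.a ^ 2 * ‖v.xs - q₀.1‖ ≤ e →
      H.a ^ 2 * ‖v.us - q₀.2‖ ≤ e → ∀ μ, 0 ≤ μ → μ ≤ 1 →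
      ‖z‖ ≤ H.ρ ∧ ‖P.rollout z v.u n‖ ≤ H.ρ ∧ ∃ q ∈ P.ZLin (P.rollout z v.u n),
        ‖P.hLin (P.rollout z v.u n) q.1 q.2
          - P.hLin z ((1 - μ) • (v.xs, v.us) + μ • q₀).1 ((1 - μ) • (v.xs, v.us) + μ • q₀).2‖
            ≤ M * s ^ 2 ∧
        ‖q.1 - z‖ ^ 2 ≤ M * s ^ 2 ∧ ‖q.1 - P.rollout z v.u n‖ ^ 2 ≤ M * s ^ 2 ∧
        ‖q.2 - v.us‖ ≤ M * (s ^ 2 + μ * e) ∧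
        ∃ y : ℕ → Vec n, y 0 = P.rollout z v.u n ∧
          (∀ k < P.N - n, y (k + 1) = P.fLin (P.rollout z v.u n) (y k) (v.u (n + k))) ∧
          ∀ k ≤ P.N - n, ‖(y k - q.1) - (v.x (n + k) - v.xs)‖ ≤ M * (s ^ 2 + μ * e) := by
  obtain ⟨G, hG, hpert⟩ := H.exists_equilibrium_sub_le
  obtain ⟨R, ε, hR, hε, hεa, hroll⟩ := H.exists_rollout_sub_le hN
  have ha := H.a_pos
  have hL := H.one_le_L
  set i := H.a⁻¹ with hi
  have hi0 : 0 < i := inv_pos.mpr ha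
  obtain ⟨g, hg⟩ : ∃ g, g = i ^ 2 + R + i := ⟨_, rfl⟩
  have hg0 : 0 ≤ g := by rw [hg]; positivity
  obtain ⟨b, hb⟩ : ∃ b, b = G * (2 * g ^ 2) := ⟨_, rfl⟩
  have hb0 : 0 ≤ b := by rw [hb]; positivity
  obtain ⟨D, hD⟩ : ∃ D, D = 2 * (2 * i + R) ^ 2 + R := ⟨_, rfl⟩
  have hD0 : 0 ≤ D := by rw [hD]; positivity
  set l := (2 * H.L) ^ P.N
  have hl0 : 0 ≤ l := by positivity
  obtain ⟨M, hM0, hM1, hM2, hM3, hM4⟩ : ∃ M : ℝ, 0 ≤ M ∧ b ≤ M ∧ (b + g) ^ 2 ≤ M ∧ i ^ 2 ≤ M ∧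
      l * D + b ≤ M :=
    ⟨b + (b + g) ^ 2 + i ^ 2 + l * D, by positivity,
      by linarith [sq_nonneg (b + g), sq_nonneg i, mul_nonneg hl0 hD0],
      by linarith [sq_nonneg (b + g), sq_nonneg i, mul_nonneg hl0 hD0],
      by linarith [sq_nonneg (b + g), sq_nonneg i, mul_nonneg hl0 hD0],
      by linarith [sq_nonneg (b + g), sq_nonneg i, mul_nonneg hl0 hD0]⟩
  refine ⟨M, min ε (1 / (R + 1)), hM0, by positivity, ?_⟩
  intro z v hv q₀ hq₀ s e he0 hes hsε' hts hex heu μ hμ0 hμ1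
  set z' := P.rollout z v.u n
  have hs0 : 0 ≤ s := he0.trans hes
  have hsε : s ≤ ε := hsε'.trans (min_le_left _ _)
  have hsR : s * (R + 1) ≤ 1 := by
    rw [← le_div_iff₀ (by positivity)]
    exact hsε'.trans (min_le_right _ _)
  have hsa : s ≤ H.a := hsε.trans hεa
  have hs1 : s ≤ 1 := hsa.trans H.a_le_one
  have hss : s ^ 2 ≤ s := by
    rw [sq]; exact mul_le_of_le_one_left hs0 hs1
  have htrack : P.trackCost v ≤ s ^ 2 := by
    rw [← Real.sq_sqrt (H.trackCost_nonneg v)]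
    exact pow_le_pow_left₀ (Real.sqrt_nonneg _) hts 2
  have hxk : ∀ k ≤ P.N, ‖v.x k‖ ≤ H.ρ - 2 := fun k hk => H.norm_state_le hv (hts.trans hsa) hk
  have hxs : ∀ k ≤ P.N, ‖v.x k - v.xs‖ ≤ i * s := fun k hk =>
    (H.norm_state_sub_le hv hk).trans (by gcongr)
  have hz : ‖z‖ ≤ H.ρ := by
    have := hxk 0 (Nat.zero_le _)
    rw [hv.initial] at this
    linarith
  have hzs : ‖z - v.xs‖ ≤ i * s := by
    have := hxs 0 (Nat.zero_le _)
    rwa [hv.initial] at this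
  have hz'n : ‖z' - v.x n‖ ≤ R * s ^ 2 := (hroll z v hv (hts.trans hsε)).trans (by gcongr)
  have hz'n1 : ‖z' - v.x n‖ ≤ R * s := hz'n.trans (by gcongr)
  have hz' : ‖z'‖ ≤ H.ρ := by
    have h2 : ‖z'‖ ≤ ‖z' - v.x n‖ + ‖v.x n‖ := by simpa using norm_add_le (z' - v.x n) (v.x n)
    have := hxk n hN
    linarith
  have hz's : ‖z' - v.xs‖ ≤ (R + i) * s := by
    have h2 : z' - v.xs = (z' - v.x n) + (v.x n - v.xs) := by abel
    rw [h2, add_mul]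
    exact (norm_add_le _ _).trans (add_le_add hz'n1 (hxs n hN))
  refine ⟨hz, hz', ?_⟩
  set qm := (1 - μ) • (v.xs, v.us) + μ • q₀ with hqm_def
  have hqm : qm ∈ P.ZLin z := convexCombination_mem_ZLin hconv hv.equilibrium hq₀ hμ0 hμ1
  have hscale : ∀ t : ℝ, H.a ^ 2 * t ≤ e → μ * t ≤ i ^ 2 * (μ * e) := by
    intro t ht
    have h1 : t ≤ i ^ 2 * e := by
      rw [hi, inv_pow, le_inv_mul_iff₀ (by positivity)]
      exact ht
    calc μ * t ≤ μ * (i ^ 2 * e) := by gcongr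
      _ = _ := by ring
  have hqm1 : ‖qm.1 - v.xs‖ ≤ i ^ 2 * (μ * e) := by
    have h1 : qm.1 - v.xs = -(μ • (v.xs - q₀.1)) := by
      simp only [hqm_def, Prod.fst_add, Prod.smul_fst]
      module
    rw [h1, norm_neg, norm_smul, Real.norm_of_nonneg hμ0]
    exact hscale _ hex
  have hqm2 : ‖qm.2 - v.us‖ ≤ i ^ 2 * (μ * e) := by
    have h1 : qm.2 - v.us = -(μ • (v.us - q₀.2)) := by
      simp only [hqm_def, Prod.snd_add, Prod.smul_snd]
      module
    rw [h1, norm_neg, norm_smul, Real.norm_of_nonneg hμ0]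
    exact hscale _ heu
  have hμe : μ * e ≤ s := (mul_le_of_le_one_left he0 hμ1).trans hes
  have hqm1s : ‖qm.1 - v.xs‖ ≤ i ^ 2 * s := hqm1.trans (by gcongr)
  have hqmz : ‖qm.1 - z‖ ≤ g * s := by
    have h2 : qm.1 - z = (qm.1 - v.xs) - (z - v.xs) := by abel
    rw [h2]
    refine (norm_sub_le _ _).trans ((add_le_add hqm1s hzs).trans ?_)
    rw [hg]
    linarith [mul_nonneg hR hs0]
  have hqmz' : ‖qm.1 - z'‖ ≤ g * s := by
    have h2 : qm.1 - z' = (qm.1 - v.xs) - (z' - v.xs) := by abel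
    rw [h2]
    refine (norm_sub_le _ _).trans ((add_le_add hqm1s hz's).trans (le_of_eq ?_))
    rw [hg]
    ring
  have hsum : G * (‖qm.1 - z‖ ^ 2 + ‖qm.1 - z'‖ ^ 2) ≤ b * s ^ 2 := by
    have h1 := pow_le_pow_left₀ (norm_nonneg _) hqmz 2
    have h2 := pow_le_pow_left₀ (norm_nonneg _) hqmz' 2
    calc _ ≤ G * ((g * s) ^ 2 + (g * s) ^ 2) := by gcongr
      _ = _ := by rw [hb]; ring
  -- Keeping the input of `qm` makes the equilibrium shift second order.
  obtain ⟨x, hx⟩ := H.exists_equilibrium z' hqm.1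
  obtain ⟨hp1, hp2⟩ := hpert z z' hz hz' qm hqm _ hx rfl
  have hxqm : ‖x - qm.1‖ ≤ b * s ^ 2 := hp1.trans hsum
  have hxqm1 : ‖x - qm.1‖ ≤ b * s := hxqm.trans (by gcongr)
  have hclose : ∀ w : Vec n, ‖qm.1 - w‖ ≤ g * s → ‖x - w‖ ^ 2 ≤ M * s ^ 2 := by
    intro w hw
    have h1 : ‖x - w‖ ≤ (b + g) * s := by
      have h2 : x - w = (x - qm.1) + (qm.1 - w) := by abel
      rw [h2, add_mul]
      exact (norm_add_le _ _).trans (add_le_add hxqm1 hw)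
    calc _ ≤ ((b + g) * s) ^ 2 := pow_le_pow_left₀ (norm_nonneg _) h1 2
      _ = (b + g) ^ 2 * s ^ 2 := by ring
      _ ≤ _ := by gcongr
  have hμe0 : 0 ≤ μ * e := mul_nonneg hμ0 he0
  refine ⟨(x, qm.2), hx, (hp2.trans hsum).trans (by gcongr), hclose z hqmz, hclose z' hqmz', ?_, ?_⟩
  · refine hqm2.trans ?_
    gcongr
    linarith [sq_nonneg s]
  let y : ℕ → Vec n := fun k => Nat.rec z' (fun k yk => P.fLin z' yk (v.u (n + k))) k
  refine ⟨y, rfl, fun k _ => rfl, fun k hk => ?_⟩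
  have hdev : ∀ k < P.N - n, ‖v.x (n + k) - z‖ ^ 2 + ‖v.x (n + k) - z'‖ ^ 2 ≤ D * s ^ 2 := by
    intro k hk
    have hk' := hxs (n + k) (by omega)
    have h1 : ‖v.x (n + k) - z‖ ≤ (2 * i + R) * s := by
      have h2 : v.x (n + k) - z = (v.x (n + k) - v.xs) - (z - v.xs) := by abel
      rw [h2]
      refine (norm_sub_le _ _).trans ((add_le_add hk' hzs).trans ?_)
      linarith [mul_nonneg hR hs0]
    have h3 : ‖v.x (n + k) - z'‖ ≤ (2 * i + R) * s := by
      have h2 : v.x (n + k) - z' = (v.x (n + k) - v.xs) - (z' - v.xs) := by abel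
      rw [h2]
      refine (norm_sub_le _ _).trans ((add_le_add hk' hz's).trans (le_of_eq (by ring)))
    have h4 := pow_le_pow_left₀ (norm_nonneg _) h1 2
    have h5 := pow_le_pow_left₀ (norm_nonneg _) h3 2
    calc _ ≤ _ := add_le_add h4 h5
      _ = 2 * (2 * i + R) ^ 2 * s ^ 2 := by ring
      _ ≤ _ := by
        rw [hD]
        gcongr
        linarith
  have htraj := H.norm_trajectory_sub_le hz hz' (K := P.N - n) (x := fun k => v.x (n + k)) (y := y)
    (u := fun k => v.u (n + k)) (fun k hk => hv.dynamics (n + k) (by omega)) (fun k _ => rfl)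
    (fun k hk => (hxk (n + k) (by omega)).trans (by linarith)) hdev
    (by
      refine hz'n.trans ?_
      rw [hD]
      gcongr
      linarith [sq_nonneg (2 * i + R)]) hk
  have hlk : (2 * H.L) ^ k ≤ l := pow_le_pow_right₀ (by linarith) (by omega)
  -- The first two differences are `O(s²)` linearization effects; the third is the deliberate move,
  -- of order `μ * e`.
  have h1 : (y k - x) - (v.x (n + k) - v.xs)
      = (y k - v.x (n + k)) - (x - qm.1) - (qm.1 - v.xs) := by abel
  calc ‖(y k - x) - (v.x (n + k) - v.xs)‖
      ≤ ‖y k - v.x (n + k)‖ + ‖x - qm.1‖ + ‖qm.1 - v.xs‖ := by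
        rw [h1]
        exact (norm_sub_le _ _).trans (by gcongr; exact norm_sub_le _ _)
    _ ≤ l * (D * s ^ 2) + b * s ^ 2 + i ^ 2 * (μ * e) := by
        gcongr
        exact htraj.trans (by gcongr)
    _ = (l * D + b) * s ^ 2 + i ^ 2 * (μ * e) := by ring
    _ ≤ M * s ^ 2 + M * (μ * e) := by gcongr
    _ = _ := by ring

end Estimates

end Setup

end LinTrackMPC

/-! ### Choice of constants and the decrease of `V`. -/

set_option maxHeartbeats 1000000 in
open LinTrackMPC LinTrackMPC.Setup in
theorem proposition2 {n m p : ℕ} (P : LinTrackMPC.Setup n m p)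
    (hstanding : P.Standing)
    (hN : n ≤ P.N)
    (hsmooth : P.Smooth)
    (hunique : P.UniqueSteadyState)
    (hctrb : P.UniformlyControllable)
    (hnonsing : P.NonSingular)
    (hcompact : P.CompactSteadyStates) :
    ∃ Vmax Jmax cV : ℝ, 0 < Vmax ∧ 0 < Jmax ∧ 0 < cV ∧ cV < 1 ∧
      ∀ (xt : LinTrackMPC.Vec n) (v : LinTrackMPC.Plan n m p),
        P.Optimal xt v →
        P.V xt ≤ Vmax →
        P.JeqLin xt ≤ Jmax →
        P.JeqLin (P.rollout xt v.u n) ≤ Jmax →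
          (∃ w, P.Feasible (P.rollout xt v.u n) w) ∧
            P.V (P.rollout xt v.u n) ≤ cV * P.V xt := by
  obtain ⟨H⟩ := nonempty_estimates hstanding hsmooth hunique hctrb hnonsing hcompact
  have hU := hstanding.compact_Us
  have hconv := hstanding.convex_Us
  have ha := H.a_pos
  obtain ⟨M, ε₀, hM, hε₀, htraj⟩ := H.exists_shifted_trajectory hN hconv
  obtain ⟨G, r, hG, hr, hcand⟩ := H.exists_shifted_candidate hN
  obtain ⟨c, r', hc, hc1, hr', htail⟩ := H.exists_sum_tail_stageCost_le hN
  obtain ⟨B, hB⟩ : ∃ B, B = G * (1 + (c / 2)⁻¹) * (2 * M ^ 2) := ⟨_, rfl⟩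
  have hB0 : 0 ≤ B := by rw [hB]; positivity
  -- The move gains `μ E₂` and costs `B μ² E₂`, so half of the gain remains.
  obtain ⟨μ, hμ, hμ1, hμB⟩ : ∃ μ : ℝ, 0 < μ ∧ μ ≤ 1 ∧ B * μ ≤ 1 / 2 := by
    refine ⟨1 / (2 * (B + 1)), by positivity, ?_, ?_⟩
    · rw [div_le_one (by positivity)]; linarith
    · rw [mul_one_div, div_le_div_iff₀ (by positivity) (by positivity)]; linarith
  -- `γ` is a common decrease rate: `(1 + c / 2) (1 - c) ≤ 1 - c / 2` for `E₁`, and `1 - μ / 2` for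
  -- `E₂`.
  obtain ⟨γ, hγ, hγc, hγμ⟩ : ∃ γ : ℝ, 0 < γ ∧ γ ≤ c / 2 ∧ γ ≤ μ / 2 :=
    ⟨min (c / 2) (μ / 2), by positivity, min_le_left _ _, min_le_right _ _⟩
  obtain ⟨θ, hθ, hoff⟩ := H.exists_offsetCost_sub_JeqLin_le hU hconv hM
    (show 0 < γ / 4 by positivity)
  obtain ⟨σ, hσ, hσ1, hσε, hσθ, hσr, hσr', hσB⟩ : ∃ σ : ℝ, 0 < σ ∧ σ ≤ 1 ∧ σ ≤ ε₀ ∧ σ ≤ θ ∧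
      σ * (2 * M + 1) ≤ r ∧ σ ≤ H.a * r' ∧ σ * (B + 1) ≤ γ / 4 := by
    refine ⟨min 1 (min ε₀ (min θ (min (r / (2 * M + 1)) (min (H.a * r') (γ / 4 / (B + 1)))))),
      by positivity, by simp, by simp, by simp, ?_, by simp, ?_⟩
    · rw [← le_div_iff₀ (by positivity)]; simp
    · rw [← le_div_iff₀ (by positivity)]; simp
  -- Of the decrease `γ V`, a quarter pays for the `O(V²)` tracking error and a quarter for the
  -- offset error; half is left.
  refine ⟨σ ^ 2, θ ^ 2, 1 - γ / 2, by positivity, by positivity, by linarith, by linarith, ?_⟩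
  intro z v hv hVmax hJ hJ'
  have hJN : P.JN z = P.cost v := by
    refine IsLeast.csInf_eq ⟨⟨v, hv.1, rfl⟩, ?_⟩
    rintro _ ⟨w, hw, rfl⟩
    exact hv.2 w hw
  obtain ⟨q₀, hq₀, hq₀J, hgrow⟩ := H.exists_optimal_equilibrium hU hconv ⟨_, hv.1.equilibrium⟩
  obtain ⟨hg1, hg2⟩ := hgrow _ hv.1.equilibrium
  set E₁ := P.trackCost v
  set E₂ := P.offsetCost z (v.xs, v.us) - P.JeqLin z with hE₂
  have hE₁0 : 0 ≤ E₁ := H.trackCost_nonneg v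
  have hE₂0 : 0 ≤ E₂ := (sq_nonneg _).trans hg1
  have hV : P.V z = E₁ + E₂ := by
    rw [V, hJN, hv.1.cost_eq, hE₂]
    ring
  have hV0 : 0 ≤ P.V z := by linarith
  set s := √(P.V z)
  have hs2 : s ^ 2 = P.V z := Real.sq_sqrt hV0
  have hs0 : 0 ≤ s := Real.sqrt_nonneg _
  have hsσ : s ≤ σ := Real.sqrt_le_left hσ.le |>.mpr hVmax
  have he2 : √E₂ ^ 2 = E₂ := Real.sq_sqrt hE₂0
  have hes : √E₂ ≤ s := Real.sqrt_le_sqrt (by linarith)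
  have hts : √E₁ ≤ s := Real.sqrt_le_sqrt (by linarith)
  obtain ⟨hz, hz', q, hq, hqh, hqz, hqz', hqu, y, hy0, hy, hyd⟩ := htraj z v hv.1 q₀ hq₀ s (√E₂)
    (Real.sqrt_nonneg _) hes (hsσ.trans hσε) hts (Real.le_sqrt_of_sq_le hg1)
    (Real.le_sqrt_of_sq_le hg2) μ hμ.le hμ1
  set z' := P.rollout z v.u n
  have hd : M * (s ^ 2 + μ * √E₂) ≤ r := by
    have h1 : s ^ 2 + μ * √E₂ ≤ 2 * σ := by
      have h2 : s ^ 2 ≤ s := by rw [sq]; exact mul_le_of_le_one_left hs0 (hsσ.trans hσ1)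
      have h3 : μ * √E₂ ≤ √E₂ := mul_le_of_le_one_left (Real.sqrt_nonneg _) hμ1
      linarith
    linarith [mul_le_mul_of_nonneg_left h1 hM]
  obtain ⟨w, hw, hwx, hwu, hcost⟩ := hcand z v hv.1 z' hz' q hq y hy0 hy _ hd hyd hqu (c / 2)
    (by positivity)
  refine ⟨⟨w, hw⟩, ?_⟩
  have htl := htail z v hv hz (by
    have h1 := H.norm_state_sub_le hv.1 (Nat.zero_le P.N)
    rw [hv.1.initial] at h1
    refine h1.trans ?_
    rw [inv_mul_le_iff₀ ha]
    exact hts.trans (hsσ.trans hσr'))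
  have hconvex := H.offsetCost_convexCombination_le z (v.xs, v.us) q₀ hμ.le hμ1
  rw [hq₀J] at hconvex
  have hqmJ : P.offsetCost z ((1 - μ) • (v.xs, v.us) + μ • q₀) - P.JeqLin z ≤ (1 - μ) * E₂ := by
    rw [hE₂]
    linarith
  have hVθ : P.V z ≤ θ ^ 2 := hVmax.trans (by gcongr)
  rw [hs2] at hqh hqz hqz'
  have hoffset := hoff z z' hz hz' _
    (convexCombination_mem_ZLin hconv hv.1.equilibrium hq₀ hμ.le hμ1) q hq (P.V z) hV0 hVθ hJ hJ'
    (hqmJ.trans (by linarith [mul_nonneg hμ.le hE₂0])) hqh hqz hqz'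
  have hJN' : P.JN z' ≤ P.cost w := by
    refine csInf_le ⟨0, ?_⟩ ⟨w, hw, rfl⟩
    rintro _ ⟨w', hw', rfl⟩
    change P.Feasible z' w' at hw'
    rw [hw'.cost_eq]
    exact add_nonneg (H.trackCost_nonneg _) (H.offsetCost_nonneg _ _)
  rw [hw.cost_eq, hwx, hwu] at hJN'
  have hquad : G * (1 + (c / 2)⁻¹) * (M * (s ^ 2 + μ * √E₂)) ^ 2
      ≤ γ / 4 * P.V z + μ / 2 * E₂ := by
    have h1 : (s ^ 2 + μ * √E₂) ^ 2 ≤ 2 * (P.V z ^ 2 + μ ^ 2 * E₂) := by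
      rw [← hs2]
      nth_rewrite 2 [← he2]
      linarith [sq_nonneg (s ^ 2 - μ * √E₂)]
    have hVσ : B * P.V z ≤ γ / 4 := by
      have : P.V z ≤ σ := hVmax.trans (by
        rw [sq]; exact mul_le_of_le_one_left hσ.le hσ1)
      linarith [mul_le_mul_of_nonneg_left this hB0]
    calc _ = G * (1 + (c / 2)⁻¹) * M ^ 2 * (s ^ 2 + μ * √E₂) ^ 2 := by ring
      _ ≤ G * (1 + (c / 2)⁻¹) * M ^ 2 * (2 * (P.V z ^ 2 + μ ^ 2 * E₂)) := by gcongr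
      _ = B * P.V z * P.V z + B * μ * (μ * E₂) := by rw [hB]; ring
      _ ≤ γ / 4 * P.V z + 1 / 2 * (μ * E₂) := by gcongr
      _ = _ := by ring
  have hfirst : (1 + c / 2) * ∑ k ∈ Finset.Ico n P.N, P.stageCost v k ≤ (1 - γ) * E₁ := by
    calc _ ≤ (1 + c / 2) * ((1 - c) * E₁) := by gcongr
      _ = ((1 + c / 2) * (1 - c)) * E₁ := by ring
      _ ≤ _ := by
        gcongr
        linarith [sq_nonneg c]
  have hγE : γ * E₂ ≤ μ / 2 * E₂ := by gcongr
  have hV' : P.V z' = P.JN z' - P.JeqLin z' := rfl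
  have hVexp : (1 - γ / 2) * P.V z = (1 - γ) * E₁ + (1 - γ) * E₂ + γ / 4 * P.V z + γ / 4 * P.V z := by
    rw [hV]; ring
  rw [hV', hVexp]
  linarith
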